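/- Let $(M^2,g)$ be a connected, oriented smooth Riemannian surface, with Gaussian curvature $K$ and Levi-Civita connection $\nabla$. For a real constant $c\neq 0$ consider the following two conditions. **(A$_c$, at a point $p\in M$)** There are positively oriented local coordinates $(u,v)$ around $p$ in which $$g=du^2+\frac{1}{f^{3/2}(u)}\,dv^2,$$ where $f=f(u)$ is a positive smooth solution, with $f'(u)>0$, of the second order ODE $$f''f-\frac74 (f')^2+\frac43 f^2+4f^4+\frac43c^2f^5=0 .$$ **(B$_c$)** At every point of $M$ one has $1+K<0$ and $\operatorname{grad}K\neq0$, and the Levi-Civita connection is given by $$\nabla_{\tilde E_1}\tilde E_1=\nabla_{\tilde E_1}\tilde E_2=0,\qquad \nabla_{\tilde E_2}\tilde E_1=-\frac34\,\frac{\tilde E_1 f}{f}\,\tilde E_2,\qquad \nabla_{\tilde E_2}\tilde E_2=\frac34\,\frac{\tilde E_1 f}{f}\,\tilde E_1,$$ where $\{\tilde E_1,\tilde E_2\}$ is the positively oriented global orthonormal frame field on $M$ with $\tilde E_1=\operatorname{grad}K/|\operatorname{grad}K|$, and $f:M\to(0,\infty)$ is now the (unique) positive solution of $$1+K+3f^2+c^2f^3=0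 .$$ Then the following holds. 1. Condition (A$_c$) holds around every point of $M$, with a constant $c\neq0$ that may a priori depend on the point, if and only if (B$_c$) holds for some real constant $c\neq0$. 2. For each fixed real constant $c\neq0$, condition (A$_c$) holds around every point of $M$ if and only if (B$_c$) holds. -/

import Mathlib

open Bundle Manifold Module Set Topology
open scoped ContDiff

noncomputable section
namespace SurfaceGeometry

section LeviCivita

variable {E : Type*} [NormedAddCommGroup E] [NormedSpace ℝ E]
  {H : Type*} [TopologicalSpace H] (I : ModelWithCorners ℝ E H)
  {M : Type*} [TopologicalSpace M] [ChartedSpace H M]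
  [RiemannianBundle (fun x : M ↦ TangentSpace I x)]

/-- The right-hand side of the Koszul formula
`2⟨∇_X Y, Z⟩ = X⟨Y, Z⟩ + Y⟨Z, X⟩ - Z⟨X, Y⟩ + ⟨[X, Y], Z⟩ - ⟨[Y, Z], X⟩ + ⟨[Z, X], Y⟩`. -/
def koszul (X Y Z : Π x : M, TangentSpace I x) (x : M) : ℝ :=
  d% (fun y ↦ inner ℝ (Y y) (Z y)) x (X x) + d% (fun y ↦ inner ℝ (Z y) (X y)) x (Y x)
    - d% (fun y ↦ inner ℝ (X y) (Y y)) x (Z x)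
    + inner ℝ (VectorField.mlieBracket I X Y x) (Z x)
    - inner ℝ (VectorField.mlieBracket I Y Z x) (X x)
    + inner ℝ (VectorField.mlieBracket I Z X x) (Y x)

variable {I}

/-- The tangent vector `v` with `⟨v, w⟩ = ℓ w` for all `w`. -/
def sharp [FiniteDimensional ℝ E] (x : M) : (TangentSpace I x →L[ℝ] ℝ) →L[ℝ] TangentSpace I x :=
  haveI : FiniteDimensional ℝ (TangentSpace I x) := ‹FiniteDimensional ℝ E›
  haveI : CompleteSpace (TangentSpace I x) := FiniteDimensional.complete ℝ (TangentSpace I x)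
  ((InnerProductSpace.toDual ℝ (TangentSpace I x)).symm :
    (TangentSpace I x →L[ℝ] ℝ) ≃ₗᵢ[ℝ] TangentSpace I x).toContinuousLinearEquiv.toContinuousLinearMap

theorem inner_sharp [FiniteDimensional ℝ E] (x : M) (l : TangentSpace I x →L[ℝ] ℝ) (w : TangentSpace I x) :
    inner ℝ (sharp x l) w = l w := by
  have : FiniteDimensional ℝ (TangentSpace I x) := ‹FiniteDimensional ℝ E›
  have : CompleteSpace (TangentSpace I x) := FiniteDimensional.complete ℝ (TangentSpace I x)
  exact InnerProductSpace.toDual_symm_apply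

theorem mdifferentiableAt_inner [IsManifold I ∞ M]
    [IsContMDiffRiemannianBundle I ∞ E (fun x : M ↦ TangentSpace I x)]
    {Y Z : Π x : M, TangentSpace I x} {x : M}
    (hY : MDiffAt (T% Y) x) (hZ : MDiffAt (T% Z) x) :
    MDiffAt (fun y ↦ (inner ℝ (Y y) (Z y) : ℝ)) x :=
  MDifferentiableAt.inner_bundle (E := fun x : M ↦ TangentSpace I x) hY hZ

variable [FiniteDimensional ℝ E] [IsManifold I ∞ M]
  [IsContMDiffRiemannianBundle I ∞ E (fun x : M ↦ TangentSpace I x)]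

theorem koszul_tensorial_fst {Y Z : Π x : M, TangentSpace I x} {x : M}
    (hY : MDiffAt (T% Y) x) (hZ : MDiffAt (T% Z) x) :
    TensorialAt I E (fun X ↦ koszul I X Y Z x) x where
  smul {f X} hf hX := by
    have h1 := mvfderiv_fun_mul hf (mdifferentiableAt_inner hZ hX)
    have h2 := mvfderiv_fun_mul hf (mdifferentiableAt_inner hX hY)
    simp only [koszul, Pi.smul_apply', inner_smul_left, inner_smul_right, conj_trivial, h1, h2,
      VectorField.mlieBracket_smul_left hf hX, VectorField.mlieBracket_smul_right hf hX]
    simp only [map_smul, inner_add_left, inner_smul_left, conj_trivial, smul_eq_mul,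
      add_apply, smul_apply,
      real_inner_comm (Z x) (X x)]
    ring
  add {X X'} hX hX' := by
    have h1 := mvfderiv_fun_add (mdifferentiableAt_inner hZ hX) (mdifferentiableAt_inner hZ hX')
    have h2 := mvfderiv_fun_add (mdifferentiableAt_inner hX hY) (mdifferentiableAt_inner hX' hY)
    simp only [koszul, Pi.add_apply, inner_add_left, inner_add_right, h1, h2,
      VectorField.mlieBracket_add_left hX hX', VectorField.mlieBracket_add_right hX hX']
    simp only [map_add, add_apply]
    ring

theorem koszul_tensorial_thd {X Y : Π x : M, TangentSpace I x} {x : M}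
    (hX : MDiffAt (T% X) x) (hY : MDiffAt (T% Y) x) :
    TensorialAt I E (fun Z ↦ koszul I X Y Z x) x where
  smul {f Z} hf hZ := by
    have h1 := mvfderiv_fun_mul hf (mdifferentiableAt_inner hY hZ)
    have h2 := mvfderiv_fun_mul hf (mdifferentiableAt_inner hZ hX)
    simp only [koszul, Pi.smul_apply', inner_smul_left, inner_smul_right, conj_trivial, h1, h2,
      VectorField.mlieBracket_smul_left hf hZ, VectorField.mlieBracket_smul_right hf hZ]
    simp only [map_smul, inner_add_left, inner_smul_left, conj_trivial, smul_eq_mul,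
      add_apply, smul_apply,
      real_inner_comm (Y x) (Z x), real_inner_comm (X x) (Z x)]
    ring
  add {Z Z'} hZ hZ' := by
    have h1 := mvfderiv_fun_add (mdifferentiableAt_inner hY hZ) (mdifferentiableAt_inner hY hZ')
    have h2 := mvfderiv_fun_add (mdifferentiableAt_inner hZ hX) (mdifferentiableAt_inner hZ' hX)
    simp only [koszul, Pi.add_apply, inner_add_left, inner_add_right, h1, h2,
      VectorField.mlieBracket_add_left hZ hZ', VectorField.mlieBracket_add_right hZ hZ']
    simp only [map_add, add_apply]
    ring

/-- The bilinear form `(X, Z) ↦ koszul X Y Z` on the tangent space at `x`. -/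
def koszulForm (Y : Π x : M, TangentSpace I x) (x : M) (hY : MDiffAt (T% Y) x) :
    TangentSpace I x →L[ℝ] TangentSpace I x →L[ℝ] ℝ :=
  TensorialAt.mkHom₂ (fun X Z ↦ koszul I X Y Z x) x
    (fun _ hZ ↦ koszul_tensorial_fst hY hZ) (fun _ hX ↦ koszul_tensorial_thd hX hY)

theorem koszulForm_apply {X Y Z : Π x : M, TangentSpace I x} {x : M}
    (hX : MDiffAt (T% X) x) (hY : MDiffAt (T% Y) x) (hZ : MDiffAt (T% Z) x) :
    koszulForm Y x hY (X x) (Z x) = koszul I X Y Z x := by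
  unfold koszulForm
  rw [TensorialAt.mkHom₂_apply _ _ hX hZ]


open scoped Classical in
/-- `leviCivitaFun Y x v` is `∇_v Y` at `x`, given by the Koszul formula (and, as for every total
function of this kind, `0` if `Y` is not differentiable at `x`). -/
def leviCivitaFun (Y : Π x : M, TangentSpace I x) (x : M) :
    TangentSpace I x →L[ℝ] TangentSpace I x :=
  if hY : MDiffAt (T% Y) x then (1 / 2 : ℝ) • (sharp x ∘L koszulForm Y x hY) else 0

theorem inner_leviCivitaFun {X Y Z : Π x : M, TangentSpace I x} {x : M}
    (hX : MDiffAt (T% X) x) (hY : MDiffAt (T% Y) x) (hZ : MDiffAt (T% Z) x) :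
    inner ℝ (leviCivitaFun Y x (X x)) (Z x) = 1 / 2 * koszul I X Y Z x := by
  simp only [leviCivitaFun, hY, dif_pos, smul_apply, ContinuousLinearMap.comp_apply,
    real_inner_smul_left, inner_sharp, koszulForm_apply hX hY hZ]

theorem inner_leviCivitaFun_extend {Y : Π x : M, TangentSpace I x} {x : M}
    (hY : MDiffAt (T% Y) x) (v w : TangentSpace I x) :
    inner ℝ (leviCivitaFun Y x v) w =
      1 / 2 * koszul I (FiberBundle.extend E v) Y (FiberBundle.extend E w) x := by
  have := inner_leviCivitaFun (FiberBundle.mdifferentiableAt_extend I E v) hY (FiberBundle.mdifferentiableAt_extend I E w)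
  simpa using this

variable (I M) in
/-- The Levi-Civita connection of the Riemannian metric: `leviCivita I M Y x v` is `∇_v Y` at `x`.
It is torsion-free (`leviCivita_torsion`) and metric (`leviCivita_metric`). -/
def leviCivita : CovariantDerivative I E (fun x : M ↦ TangentSpace I x) where
  toFun := leviCivitaFun
  isCovariantDerivativeOnUniv := by
    refine ⟨fun {Y Y' x} hY hY' _ ↦ ?_, fun {Y f x} hY hf _ ↦ ?_⟩
    · refine ContinuousLinearMap.ext fun v ↦ ext_inner_right ℝ fun w ↦ ?_
      have hX := FiberBundle.mdifferentiableAt_extend I E v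
      have hZ := FiberBundle.mdifferentiableAt_extend I E w
      have h1 := mvfderiv_fun_add (mdifferentiableAt_inner hY hZ) (mdifferentiableAt_inner hY' hZ)
      have h2 := mvfderiv_fun_add (mdifferentiableAt_inner hX hY) (mdifferentiableAt_inner hX hY')
      rw [inner_leviCivitaFun_extend (mdifferentiableAt_add_section hY hY'), add_apply,
        inner_add_left, inner_leviCivitaFun_extend hY, inner_leviCivitaFun_extend hY']
      simp only [koszul, Pi.add_apply, inner_add_left, inner_add_right, h1, h2,
        VectorField.mlieBracket_add_left hY hY', VectorField.mlieBracket_add_right hY hY',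
        map_add, add_apply]
      ring
    · refine ContinuousLinearMap.ext fun v ↦ ext_inner_right ℝ fun w ↦ ?_
      have hX := FiberBundle.mdifferentiableAt_extend I E v
      have hZ := FiberBundle.mdifferentiableAt_extend I E w
      have h1 := mvfderiv_fun_mul hf (mdifferentiableAt_inner hY hZ)
      have h2 := mvfderiv_fun_mul hf (mdifferentiableAt_inner hX hY)
      rw [inner_leviCivitaFun_extend (hf.smul_section hY), add_apply,
        inner_add_left, smul_apply, real_inner_smul_left, inner_leviCivitaFun_extend hY]
      simp only [koszul, Pi.smul_apply', inner_smul_left, inner_smul_right, conj_trivial, h1, h2,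
        VectorField.mlieBracket_smul_left hf hY, VectorField.mlieBracket_smul_right hf hY]
      simp only [map_smul, inner_add_left, inner_smul_left, conj_trivial, smul_eq_mul,
        add_apply, smul_apply, ContinuousLinearMap.smulRight_apply, FiberBundle.extend_apply_self,
        real_inner_comm v (Y x), real_inner_comm w (Y x)]
      ring

theorem leviCivita_torsion : (leviCivita I M).torsion = 0 := by
  rw [CovariantDerivative.torsion_eq_zero_iff]
  intro X Y x hX hY
  refine ext_inner_right ℝ fun w ↦ ?_
  have hZ := FiberBundle.mdifferentiableAt_extend I E w
  have h1 := inner_leviCivitaFun hX hY hZ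
  have h2 := inner_leviCivitaFun hY hX hZ
  rw [FiberBundle.extend_apply_self] at h1 h2
  change inner ℝ (leviCivitaFun Y x (X x) - leviCivitaFun X x (Y x)) w = _
  rw [inner_sub_left, h1, h2]
  simp only [koszul, VectorField.mlieBracket_swap_apply (V := Y) (W := X),
     VectorField.mlieBracket_swap_apply (V := X) (W := FiberBundle.extend E w),
     VectorField.mlieBracket_swap_apply (V := Y) (W := FiberBundle.extend E w), inner_neg_left,
     real_inner_comm, FiberBundle.extend_apply_self]
  ring

theorem leviCivita_metric {X Y Z : Π x : M, TangentSpace I x} {x : M}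
    (hX : MDiffAt (T% X) x) (hY : MDiffAt (T% Y) x) (hZ : MDiffAt (T% Z) x) :
    d% (fun y ↦ (inner ℝ (Y y) (Z y) : ℝ)) x (X x) =
      inner ℝ (leviCivita I M Y x (X x)) (Z x) + inner ℝ (Y x) (leviCivita I M Z x (X x)) := by
  have h1 := inner_leviCivitaFun hX hY hZ
  have h2 := inner_leviCivitaFun hX hZ hY
  rw [real_inner_comm (leviCivita I M Z x (X x)) (Y x)]
  change _ = inner ℝ (leviCivitaFun Y x (X x)) (Z x) + inner ℝ (leviCivitaFun Z x (X x)) (Y x)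
  rw [h1, h2]
  simp only [koszul, VectorField.mlieBracket_swap_apply (V := Y) (W := X),
     VectorField.mlieBracket_swap_apply (V := X) (W := Z),
     VectorField.mlieBracket_swap_apply (V := Z) (W := Y), inner_neg_left,
     real_inner_comm]
  ring

/-- `R(X, Y)Z = ∇_X ∇_Y Z - ∇_Y ∇_X Z - ∇_{[X, Y]} Z`. -/
def curvature (X Y Z : Π x : M, TangentSpace I x) (x : M) : TangentSpace I x :=
  leviCivita I M (fun y ↦ leviCivita I M Z y (Y y)) x (X x)
    - leviCivita I M (fun y ↦ leviCivita I M Z y (X y)) x (Y x)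
    - leviCivita I M Z x (VectorField.mlieBracket I X Y x)

/-- The sectional curvature `⟨R(v, w)w, v⟩ / (|v|² |w|² - ⟨v, w⟩²)` of the plane spanned by `v, w`.
The curvature tensor is evaluated on extensions of `v` and `w` to vector fields that are smooth
near `x`; its value at `x` does not depend on them. -/
def sectionalCurvature {x : M} (v w : TangentSpace I x) : ℝ :=
  inner ℝ (curvature (FiberBundle.extend E v) (FiberBundle.extend E w)
      (FiberBundle.extend E w) x) v /
    (inner ℝ v v * inner ℝ w w - inner ℝ v w ^ 2)

end LeviCivita

section Gradient

variable {E : Type*} [NormedAddCommGroup E] [NormedSpace ℝ E]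
  {H : Type*} [TopologicalSpace H] (I : ModelWithCorners ℝ E H)
  {M : Type*} [TopologicalSpace M] [ChartedSpace H M]
  [RiemannianBundle (fun x : M ↦ TangentSpace I x)] [FiniteDimensional ℝ E]

/-- The gradient of a function: `⟨grad h, v⟩ = dh(v)`. -/
def gradient (h : M → ℝ) (x : M) : TangentSpace I x := sharp x (d% h x)

end Gradient

section Surface

/-- The model space of surfaces. -/
abbrev Plane : Type := EuclideanSpace ℝ (Fin 2)

variable {M : Type*} [TopologicalSpace M] [ChartedSpace Plane M]

/-- The basis of the tangent space at `x` that corresponds to the standard basis of `ℝ²` under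
Mathlib's identification of the tangent space with `ℝ²` (given by the preferred chart at `x`). -/
def tangentBasis (x : M) : Module.Basis (Fin 2) ℝ (TangentSpace (𝓡 2) x) :=
  (EuclideanSpace.basisFun (Fin 2) ℝ).toBasis

/-- The coordinate vector fields `∂/∂x₀, ∂/∂x₁` of a chart `φ`, at the point with
coordinates `q`: the images of the standard basis of `ℝ²` under the derivative of `φ⁻¹` at `q`. -/
def coordVec (φ : OpenPartialHomeomorph M Plane) (q : Plane) (i : Fin 2) :
    TangentSpace (𝓡 2) (φ.symm q) :=
  mfderiv (𝓡 2) (𝓡 2) φ.symm q (tangentBasis q i)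

/-- `v` is a basis of `V` that is positive for the orientation `o`. -/
def IsPositiveBasis {V : Type*} [AddCommGroup V] [Module ℝ V] (o : Orientation ℝ V (Fin 2))
    (v : Fin 2 → V) : Prop :=
  ∃ b : Module.Basis (Fin 2) ℝ V, ⇑b = v ∧ b.orientation = o

/-- A chart of the smooth surface `M` whose coordinate frame is positive for the given
orientations of the tangent planes. -/
structure IsPositiveChart (o : ∀ x : M, Orientation ℝ (TangentSpace (𝓡 2) x) (Fin 2))
    (φ : OpenPartialHomeomorph M Plane) : Prop where
  mem_maximalAtlas : φ ∈ IsManifold.maximalAtlas (𝓡 2) ∞ M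
  positive : ∀ q ∈ φ.target, IsPositiveBasis (o (φ.symm q)) (coordVec φ q)

variable (M) in
/-- An orientation of a smooth surface: orientations of the tangent planes such that positive
charts exist around every point. -/
structure SurfaceOrientation where
  toFun : ∀ x : M, Orientation ℝ (TangentSpace (𝓡 2) x) (Fin 2)
  exists_positiveChart : ∀ p : M, ∃ φ : OpenPartialHomeomorph M Plane,
    p ∈ φ.source ∧ IsPositiveChart toFun φ

variable [RiemannianBundle (fun x : M ↦ TangentSpace (𝓡 2) x)]

/-- The chart `φ = (u, v)` is positively oriented, the metric is `du² + f(u)^(-3/2) dv²` in it,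
and, for all `u` in the range of the first coordinate, `f` is a smooth function with `f > 0`,
`f' > 0` and `f'' f - 7/4 f'² + 4/3 f² + 4 f⁴ + 4/3 c² f⁵ = 0`. -/
structure IsSpecialChart (o : SurfaceOrientation M) (c : ℝ) (φ : OpenPartialHomeomorph M Plane)
    (f : ℝ → ℝ) : Prop where
  positive : IsPositiveChart o.toFun φ
  smooth : ContDiffOn ℝ ∞ f ((fun q : Plane ↦ q 0) '' φ.target)
  pos : ∀ u ∈ (fun q : Plane ↦ q 0) '' φ.target, 0 < f u
  deriv_pos : ∀ u ∈ (fun q : Plane ↦ q 0) '' φ.target, 0 < deriv f u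
  ode : ∀ u ∈ (fun q : Plane ↦ q 0) '' φ.target,
    deriv (deriv f) u * f u - 7 / 4 * deriv f u ^ 2 + 4 / 3 * f u ^ 2 + 4 * f u ^ 4
      + 4 / 3 * c ^ 2 * f u ^ 5 = 0
  metric_uu : ∀ q ∈ φ.target, inner ℝ (coordVec φ q 0) (coordVec φ q 0) = (1 : ℝ)
  metric_uv : ∀ q ∈ φ.target, inner ℝ (coordVec φ q 0) (coordVec φ q 1) = (0 : ℝ)
  metric_vv : ∀ q ∈ φ.target,
    inner ℝ (coordVec φ q 1) (coordVec φ q 1) = 1 / f (q 0) ^ (3 / 2 : ℝ)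

variable [IsManifold (𝓡 2) ∞ M]
  [IsContMDiffRiemannianBundle (𝓡 2) ∞ Plane (fun x : M ↦ TangentSpace (𝓡 2) x)]

variable (M) in
/-- The Gaussian curvature: the sectional curvature of the tangent plane, computed in some basis
of it. -/
def gaussCurvature (x : M) : ℝ :=
  sectionalCurvature (tangentBasis x 0) (tangentBasis x 1)

/-- `E₁ = grad K / |grad K|` and `(E₁, E₂)` is a positively oriented orthonormal frame field. -/
structure IsCurvatureFrame (o : SurfaceOrientation M) (E₁ E₂ : Π x : M, TangentSpace (𝓡 2) x) :
    Prop where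
  eq_gradient : ∀ x, E₁ x = ‖gradient (𝓡 2) (gaussCurvature M) x‖⁻¹ •
    gradient (𝓡 2) (gaussCurvature M) x
  orthonormal : ∀ x, Orthonormal ℝ ![E₁ x, E₂ x]
  positive : ∀ x, IsPositiveBasis (o.toFun x) ![E₁ x, E₂ x]

/-- The Gaussian curvature `K` satisfies `1 + K < 0` and `grad K ≠ 0` everywhere, and the
Levi-Civita connection has the prescribed form in the frame `E₁ = grad K / |grad K|, E₂`, where
`f` is the positive root of `1 + K + 3 f² + c² f³ = 0`. -/
def HasSpecialConnection (o : SurfaceOrientation M) (c : ℝ) : Prop :=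
  (∀ x, 1 + gaussCurvature M x < 0) ∧
  (∀ x, gradient (𝓡 2) (gaussCurvature M) x ≠ 0) ∧
  ∃ f : M → ℝ,
    (∀ x, 0 < f x ∧ 1 + gaussCurvature M x + 3 * f x ^ 2 + c ^ 2 * f x ^ 3 = 0) ∧
    ∃ E₁ E₂ : Π x : M, TangentSpace (𝓡 2) x, IsCurvatureFrame o E₁ E₂ ∧
      ∀ x, leviCivita (𝓡 2) M E₁ x (E₁ x) = 0 ∧
        leviCivita (𝓡 2) M E₂ x (E₁ x) = 0 ∧
        leviCivita (𝓡 2) M E₁ x (E₂ x) = -(3 / 4 * (mvfderiv (𝓡 2) f x (E₁ x) / f x)) • E₂ x ∧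
        leviCivita (𝓡 2) M E₂ x (E₂ x) = (3 / 4 * (mvfderiv (𝓡 2) f x (E₁ x) / f x)) • E₁ x

end Surface
end SurfaceGeometry

end

/-!
Both conditions describe the same thing: an orthonormal frame `E₁, E₂` and a positive function `f`,
decreasing along `E₁` and constant along `E₂`, with `[E₁, E₂] = 3/4 (E₁ f / f) E₂` and
`K = -1 - 3 f² - c² f³`. Everything is expressed by the two coefficients `a = ⟨∇_{e₁} e₁, e₂⟩` and
`b = ⟨∇_{e₂} e₁, e₂⟩` of an orthonormal frame: they are read off from `[e₁, e₂] = -a e₁ - b e₂`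
(`IsFrameOn.mlieBracket_eq`) and give the curvature, `K = -e₁ b + e₂ a - a² - b²`
(`IsFrameOn.gaussCurvature_eq`).

In a special chart the frame `-∂/∂u, -f^(3/4) ∂/∂v` has `a = 0` and `b = 3/4 f'/f`. The curvature
formula turns the differential equation for `f` into `1 + K + 3 f² + c² f³ = 0`
(`IsSpecialChart.gaussCurvature_eq`). As `f' > 0`, the gradient of `K` is a positive multiple of
`-∂/∂u`, so the frame is the one built from `grad K`; in particular the frames of overlapping charts
agree, and the root `f` is unique, whence the global statement
(`hasSpecialConnection_of_forall_isSpecialChart`). If the constant may depend on the point, it is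
recovered up to sign from the geometry: the value of `3 f² + c² f³` and that of its derivative along
`E₁` divided by `E₁ f / f` determine both `f` and `c²` (`IsSpecialAt.sq_eq_sq`). Hence `c²` is
locally constant, and it is constant as the surface is connected (`exists_hasSpecialConnection`).

Conversely, `f` is smooth by the inverse function theorem. The field `E₂` is not assumed to be
smooth, but `∇_{E₂} E₂ ≠ 0` excludes the value `0` that the connection takes at fields which are not
differentiable, and a differentiable completion of a smooth unit field to an orthonormal frame is
smooth (`HasSpecialConnection.exists_isSpecialFrame`). The form of the connection then says that
`-E₁` and `-f^(-3/4) E₂` commute. Commuting independent fields are coordinate fields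
(`exists_rectification`, `exists_chartField_eq`), because the dual coframe is closed and, by the
Poincaré lemma, exact. In the resulting chart `f` depends on the first coordinate only, the metric
has the required form, and the curvature formula, read backwards, is the differential equation
(`IsSpecialFrame.exists_isSpecialChart`).
-/

noncomputable section

namespace SurfaceGeometry

/-! ### Functions and vector fields on a surface -/

section FieldCalculus

variable {M : Type*} [TopologicalSpace M] [ChartedSpace Plane M]

/-- Differentiability at a point of a function on a surface. -/
abbrev DiffFunAt (f : M → ℝ) (x : M) : Prop := MDifferentiableAt (𝓡 2) 𝓘(ℝ, ℝ) f x

/-- Smoothness at a point of a function on a surface. -/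
abbrev SmoothFunAt (f : M → ℝ) (x : M) : Prop := ContMDiffAt (𝓡 2) 𝓘(ℝ, ℝ) ∞ f x

/-- The derivative of the function `f` along the vector field `V`. -/
def dirDeriv (V : Π x : M, TangentSpace (𝓡 2) x) (f : M → ℝ) (x : M) : ℝ :=
  mvfderiv (𝓡 2) f x (V x)

variable {V W : Π x : M, TangentSpace (𝓡 2) x} {f g : M → ℝ} {x : M}

theorem dirDeriv_add (hf : DiffFunAt f x) (hg : DiffFunAt g x) :
    dirDeriv V (fun y ↦ f y + g y) x = dirDeriv V f x + dirDeriv V g x := by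
  simp [dirDeriv, mvfderiv_fun_add hf hg]

theorem dirDeriv_neg : dirDeriv V (fun y ↦ -f y) x = -dirDeriv V f x := by
  simp [dirDeriv, mvfderiv_fun_neg]

theorem dirDeriv_mul (hf : DiffFunAt f x) (hg : DiffFunAt g x) :
    dirDeriv V (fun y ↦ f y * g y) x = f x * dirDeriv V g x + g x * dirDeriv V f x := by
  simp [dirDeriv, mvfderiv_fun_mul hf hg]

theorem dirDeriv_const (c : ℝ) : dirDeriv V (fun _ ↦ c) x = 0 := by
  simp [dirDeriv, mvfderiv_const]

theorem dirDeriv_congr (h : f =ᶠ[𝓝 x] g) : dirDeriv V f x = dirDeriv V g x := by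
  simp only [dirDeriv, mvfderiv, h.mfderiv_eq]
  rfl

theorem dirDeriv_eq_of_eq_smul_add {e₁ e₂ : Π x : M, TangentSpace (𝓡 2) x} {v w : ℝ}
    (h : V x = v • e₁ x + w • e₂ x) (f : M → ℝ) :
    dirDeriv V f x = v * dirDeriv e₁ f x + w * dirDeriv e₂ f x := by
  simp [dirDeriv, h]

/-- The chain rule for the derivative along a vector field. -/
theorem dirDeriv_comp_real {φ : ℝ → ℝ} {φ' : ℝ} (hφ : HasDerivAt φ φ' (f x))
    (hf : DiffFunAt f x) : dirDeriv V (fun y ↦ φ (f y)) x = φ' * dirDeriv V f x := by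
  have h2 := (hφ.hasFDerivAt.hasMFDerivAt.comp x hf.hasMFDerivAt).mfderiv
  simp only [dirDeriv, mvfderiv]
  change (mfderiv (𝓡 2) 𝓘(ℝ, ℝ) (φ ∘ f) x (V x) : ℝ) =
    φ' * (show ℝ from mfderiv (𝓡 2) 𝓘(ℝ, ℝ) f x (V x))
  rw [h2, mul_comm]
  rfl

theorem smoothFunAt_comp_real {φ : ℝ → ℝ} (hφ : ContDiffAt ℝ ∞ φ (f x))
    (hf : SmoothFunAt f x) : SmoothFunAt (fun y ↦ φ (f y)) x :=
  hφ.contMDiffAt.comp x hf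

theorem smoothFunAt_add (hf : SmoothFunAt f x) (hg : SmoothFunAt g x) :
    SmoothFunAt (fun y ↦ f y + g y) x := hf.add hg

theorem smoothFunAt_neg (hf : SmoothFunAt f x) : SmoothFunAt (fun y ↦ -f y) x := hf.neg

theorem smoothFunAt_mul (hf : SmoothFunAt f x) (hg : SmoothFunAt g x) :
    SmoothFunAt (fun y ↦ f y * g y) x := hf.mul hg

theorem _root_.ContMDiffAt.diffFunAt (hf : SmoothFunAt f x) : DiffFunAt f x :=
  hf.mdifferentiableAt (by simp)

variable [IsManifold (𝓡 2) ∞ M]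

/-- Differentiability at a point of a vector field on a surface. -/
abbrev DiffFieldAt (V : Π x : M, TangentSpace (𝓡 2) x) (x : M) : Prop :=
  MDifferentiableAt (𝓡 2) ((𝓡 2).prod 𝓘(ℝ, Plane)) (fun y ↦ TotalSpace.mk' Plane y (V y)) x

/-- Smoothness at a point of a vector field on a surface. -/
abbrev SmoothFieldAt (V : Π x : M, TangentSpace (𝓡 2) x) (x : M) : Prop :=
  ContMDiffAt (𝓡 2) ((𝓡 2).prod 𝓘(ℝ, Plane)) ∞ (fun y ↦ TotalSpace.mk' Plane y (V y)) x

theorem _root_.ContMDiffAt.diffFieldAt (hV : SmoothFieldAt V x) : DiffFieldAt V x :=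
  hV.mdifferentiableAt (by simp)

theorem mlieBracket_smul_right_apply (hf : DiffFunAt f x) (hW : DiffFieldAt W x) :
    VectorField.mlieBracket (𝓡 2) V (fun y ↦ f y • W y) x =
      dirDeriv V f x • W x + f x • VectorField.mlieBracket (𝓡 2) V W x :=
  VectorField.mlieBracket_smul_right (I := 𝓡 2) (V := V) hf hW

theorem eventually_diffFieldAt (hV : SmoothFieldAt V x) : ∀ᶠ y in 𝓝 x, DiffFieldAt V y := by
  have h1 : ContMDiffAt (𝓡 2) ((𝓡 2).prod 𝓘(ℝ, Plane)) 1
    (fun y ↦ TotalSpace.mk' Plane y (V y)) x := hV.of_le (by simp)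
  filter_upwards [(contMDiffAt_iff_contMDiffAt_nhds (by simp)).1 h1] with y hy
  exact hy.mdifferentiableAt (by simp)

theorem eventually_diffFunAt (hf : SmoothFunAt f x) : ∀ᶠ y in 𝓝 x, DiffFunAt f y := by
  have h1 : ContMDiffAt (𝓡 2) 𝓘(ℝ, ℝ) 1 f x := hf.of_le (by simp)
  filter_upwards [(contMDiffAt_iff_contMDiffAt_nhds (by simp)).1 h1] with y hy
  exact hy.mdifferentiableAt (by simp)

theorem smoothFieldAt_mlieBracket (hV : SmoothFieldAt V x) (hW : SmoothFieldAt W x) :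
    SmoothFieldAt (VectorField.mlieBracket (𝓡 2) V W) x := by
  have : IsManifold (𝓡 2) (((⊤ : ℕ∞) : ℕ∞ω) + 1) M := by
    simpa using (inferInstance : IsManifold (𝓡 2) ∞ M)
  have : IsManifold (𝓡 2) (minSmoothness ℝ 2) M := by
    simp only [minSmoothness_of_isRCLikeNormedField]
    infer_instance
  exact ContMDiffAt.mlieBracket_vectorField (n := ⊤) (m := ⊤) hV hW (by simp)

/-- The Lie bracket acts on functions as the commutator of derivations. This is the coefficient
of a nonvanishing field `U` in the Jacobi identity for `V`, `W` and `f U`. -/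
theorem dirDeriv_mlieBracket (hV : SmoothFieldAt V x) (hW : SmoothFieldAt W x)
    (hf : SmoothFunAt f x) (hVf : DiffFunAt (dirDeriv V f) x) (hWf : DiffFunAt (dirDeriv W f) x) :
    dirDeriv (VectorField.mlieBracket (𝓡 2) V W) f x =
      dirDeriv V (dirDeriv W f) x - dirDeriv W (dirDeriv V f) x := by
  have : IsManifold (𝓡 2) (minSmoothness ℝ 3) M := by
    simp only [minSmoothness_of_isRCLikeNormedField]
    infer_instance
  obtain ⟨u, hu⟩ : ∃ u : Plane, u ≠ 0 := exists_ne 0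
  let U : Π y : M, TangentSpace (𝓡 2) y :=
    FiberBundle.extend Plane (show TangentSpace (𝓡 2) x from u)
  have hUx : U x = u := FiberBundle.extend_apply_self ..
  have hU : SmoothFieldAt U x := FiberBundle.contMDiffAt_extend (𝓡 2) Plane _
  have hfU : SmoothFieldAt (fun y ↦ f y • U y) x := hf.smul_section hU
  have e2 : minSmoothness ℝ 2 ≤ (∞ : ℕ∞ω) := by
    simp only [minSmoothness_of_isRCLikeNormedField]; exact ENat.LEInfty.out
  have J := VectorField.leibniz_identity_mlieBracket_apply (I := 𝓡 2)
    (hV.of_le e2) (hW.of_le e2) (hU.of_le e2)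
  have Jf := VectorField.leibniz_identity_mlieBracket_apply (I := 𝓡 2)
    (hV.of_le e2) (hW.of_le e2) (hfU.of_le e2)
  have hVW := smoothFieldAt_mlieBracket hV hW
  have hVU := smoothFieldAt_mlieBracket hV hU
  have hWU := smoothFieldAt_mlieBracket hW hU
  have key {A : Π x : M, TangentSpace (𝓡 2) x} :
      VectorField.mlieBracket (𝓡 2) A (fun y ↦ f y • U y) =ᶠ[𝓝 x]
      (fun y ↦ dirDeriv A f y • U y) + (fun y ↦ f y • VectorField.mlieBracket (𝓡 2) A U y) := by
    filter_upwards [eventually_diffFunAt hf, eventually_diffFieldAt hU] with y h1 h2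
    exact mlieBracket_smul_right_apply h1 h2
  have key2 {A B : Π x : M, TangentSpace (𝓡 2) x} (hAf : DiffFunAt (dirDeriv A f) x)
      (hAU : DiffFieldAt (VectorField.mlieBracket (𝓡 2) A U) x) :
      VectorField.mlieBracket (𝓡 2) B (VectorField.mlieBracket (𝓡 2) A (fun y ↦ f y • U y)) x =
      dirDeriv B (dirDeriv A f) x • U x + dirDeriv A f x • VectorField.mlieBracket (𝓡 2) B U x +
      (dirDeriv B f x • VectorField.mlieBracket (𝓡 2) A U x +
       f x • VectorField.mlieBracket (𝓡 2) B (VectorField.mlieBracket (𝓡 2) A U) x) := by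
    rw [Filter.EventuallyEq.mlieBracket_vectorField_eq (Filter.EventuallyEq.refl _ B) key]
    refine Eq.trans (VectorField.mlieBracket_add_right (hAf.smul_section hU.diffFieldAt)
        (hf.diffFunAt.smul_section hAU)) ?_
    rw [mlieBracket_smul_right_apply hAf hU.diffFieldAt,
      mlieBracket_smul_right_apply hf.diffFunAt hAU]
  rw [key2 hWf hWU.diffFieldAt, key2 hVf hVU.diffFieldAt,
    mlieBracket_smul_right_apply hf.diffFunAt hU.diffFieldAt, J] at Jf
  have : (dirDeriv (VectorField.mlieBracket (𝓡 2) V W) f x -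
      (dirDeriv V (dirDeriv W f) x - dirDeriv W (dirDeriv V f) x)) • U x = 0 := by
    rw [sub_smul, sub_smul]
    rw [smul_add] at Jf
    rw [← sub_eq_zero.2 Jf.symm]
    abel
  rcases smul_eq_zero.1 this with h | h
  · linarith
  · exact absurd (hUx.symm.trans h) hu

variable [RiemannianBundle (fun x : M ↦ TangentSpace (𝓡 2) x)]
  [IsContMDiffRiemannianBundle (𝓡 2) ∞ Plane (fun x : M ↦ TangentSpace (𝓡 2) x)]

theorem smoothFunAt_inner (hV : SmoothFieldAt V x) (hW : SmoothFieldAt W x) :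
    SmoothFunAt (fun y ↦ (inner ℝ (V y) (W y) : ℝ)) x :=
  ContMDiffAt.inner_bundle (E := fun x : M ↦ TangentSpace (𝓡 2) x) hV hW

theorem diffFunAt_inner (hV : DiffFieldAt V x) (hW : DiffFieldAt W x) :
    DiffFunAt (fun y ↦ (inner ℝ (V y) (W y) : ℝ)) x :=
  mdifferentiableAt_inner hV hW

/-- The function `V f` is smooth, because `(V f) U = [V, f U] - f [V, U]` for a nonvanishing
field `U`. -/
theorem smoothFunAt_dirDeriv (hV : SmoothFieldAt V x) (hf : SmoothFunAt f x) :
    SmoothFunAt (dirDeriv V f) x := by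
  obtain ⟨u, hu⟩ : ∃ u : Plane, u ≠ 0 := exists_ne 0
  let U : Π y : M, TangentSpace (𝓡 2) y :=
    FiberBundle.extend Plane (show TangentSpace (𝓡 2) x from u)
  have hUx : U x = u := FiberBundle.extend_apply_self ..
  have hU : SmoothFieldAt U x := FiberBundle.contMDiffAt_extend (𝓡 2) Plane _
  have hfU : SmoothFieldAt (fun y ↦ f y • U y) x := hf.smul_section hU
  have hUU := smoothFunAt_inner hU hU
  have hne : (inner ℝ (U x) (U x) : ℝ) ≠ 0 := by
    rw [inner_self_ne_zero, hUx]; exact hu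
  have h1 := smoothFunAt_inner (smoothFieldAt_mlieBracket hV hfU) hU
  have h2 := smoothFunAt_inner (smoothFieldAt_mlieBracket hV hU) hU
  refine ((h1.sub (hf.mul h2)).div₀ hUU hne).congr_of_eventuallyEq ?_
  filter_upwards [eventually_diffFunAt hf, eventually_diffFieldAt hU,
    hUU.continuousAt.eventually_ne hne] with y h1 h2 h3
  simp only [Pi.mul_apply, Pi.div_apply, mlieBracket_smul_right_apply h1 h2,
    inner_add_left, real_inner_smul_left]
  field_simp
  ring

end FieldCalculus

/-! ### Orthonormal frames and their connection form -/

section OrthonormalPair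

variable {V : Type*} [NormedAddCommGroup V] [InnerProductSpace ℝ V]

theorem eq_inner_smul_add_of_orthonormal (hV : Module.finrank ℝ V = 2) {e₁ e₂ : V}
    (h₁₁ : inner ℝ e₁ e₁ = (1 : ℝ)) (h₁₂ : inner ℝ e₁ e₂ = (0 : ℝ))
    (h₂₂ : inner ℝ e₂ e₂ = (1 : ℝ)) (v : V) :
    v = (inner ℝ v e₁ : ℝ) • e₁ + (inner ℝ v e₂ : ℝ) • e₂ := by
  have ho : Orthonormal ℝ ![e₁, e₂] := by
    rw [orthonormal_iff_ite]
    intro i j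
    fin_cases i <;> fin_cases j <;>
      simp [h₁₁, h₁₂, h₂₂, real_inner_comm e₁ e₂, -inner_self_eq_norm_sq_to_K]
  have : FiniteDimensional ℝ V := FiniteDimensional.of_finrank_pos (by omega)
  let b := OrthonormalBasis.mk ho (by
    rw [ho.linearIndependent.span_eq_top_of_card_eq_finrank (by simp [hV])])
  have := b.sum_repr' v
  simp only [Fin.sum_univ_two, b, OrthonormalBasis.coe_mk] at this
  rw [real_inner_comm e₁ v, real_inner_comm e₂ v]
  simpa using this.symm

end OrthonormalPair

section Frame

variable {M : Type*} [TopologicalSpace M] [ChartedSpace Plane M]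
  [IsManifold (𝓡 2) ∞ M] [RiemannianBundle (fun x : M ↦ TangentSpace (𝓡 2) x)]

/-- A smooth orthonormal frame field on the open set `U` of a surface. -/
structure IsFrameOn (e₁ e₂ : Π x : M, TangentSpace (𝓡 2) x) (U : Set M) : Prop where
  isOpen : IsOpen U
  smooth₁ : ∀ x ∈ U, SmoothFieldAt e₁ x
  smooth₂ : ∀ x ∈ U, SmoothFieldAt e₂ x
  inner₁₁ : ∀ x ∈ U, inner ℝ (e₁ x) (e₁ x) = (1 : ℝ)
  inner₁₂ : ∀ x ∈ U, inner ℝ (e₁ x) (e₂ x) = (0 : ℝ)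
  inner₂₂ : ∀ x ∈ U, inner ℝ (e₂ x) (e₂ x) = (1 : ℝ)

theorem IsFrameOn.eq_inner_smul_add {e₁ e₂ : Π x : M, TangentSpace (𝓡 2) x} {U : Set M}
    {x : M} (h : IsFrameOn e₁ e₂ U) (hx : x ∈ U) (v : TangentSpace (𝓡 2) x) :
    v = (inner ℝ v (e₁ x) : ℝ) • e₁ x + (inner ℝ v (e₂ x) : ℝ) • e₂ x :=
  eq_inner_smul_add_of_orthonormal (V := TangentSpace (𝓡 2) x)
    (finrank_euclideanSpace_fin (𝕜 := ℝ) (n := 2))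
    (h.inner₁₁ x hx) (h.inner₁₂ x hx) (h.inner₂₂ x hx) v

variable [IsContMDiffRiemannianBundle (𝓡 2) ∞ Plane (fun x : M ↦ TangentSpace (𝓡 2) x)]

/-- The connection form `ω(v) = ⟨∇_v e₁, e₂⟩` of a frame `e₁, e₂`. -/
def connForm (e₁ e₂ : Π x : M, TangentSpace (𝓡 2) x) (x : M) (v : TangentSpace (𝓡 2) x) : ℝ :=
  inner ℝ (leviCivita (𝓡 2) M e₁ x v) (e₂ x)

/-- The geodesic curvature `⟨∇_{e₁} e₁, e₂⟩` of the integral curves of `e₁`. -/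
def connFst (e₁ e₂ : Π x : M, TangentSpace (𝓡 2) x) (x : M) : ℝ := connForm e₁ e₂ x (e₁ x)

/-- The coefficient `⟨∇_{e₂} e₁, e₂⟩`, up to sign the geodesic curvature of the integral curves of
`e₂`. -/
def connSnd (e₁ e₂ : Π x : M, TangentSpace (𝓡 2) x) (x : M) : ℝ := connForm e₁ e₂ x (e₂ x)

variable {e₁ e₂ V W : Π x : M, TangentSpace (𝓡 2) x} {U : Set M} {x : M} {p q : M → ℝ}

theorem leviCivita_congr (hV : DiffFieldAt V x) (hW : DiffFieldAt W x) (h : V =ᶠ[𝓝 x] W) :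
    leviCivita (𝓡 2) M V x = leviCivita (𝓡 2) M W x :=
  (leviCivita (𝓡 2) M).isCovariantDerivativeOnUniv.congr_of_eventuallyEq hV hW Filter.univ_mem h

theorem leviCivita_sub_swap (hV : DiffFieldAt V x) (hW : DiffFieldAt W x) :
    leviCivita (𝓡 2) M W x (V x) - leviCivita (𝓡 2) M V x (W x) =
      VectorField.mlieBracket (𝓡 2) V W x :=
  ((leviCivita (𝓡 2) M).torsion_eq_zero_iff.1 leviCivita_torsion) hV hW

theorem mvfderiv_inner (hV : DiffFieldAt V x) (hW : DiffFieldAt W x) (v : TangentSpace (𝓡 2) x) :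
    mvfderiv (𝓡 2) (fun y ↦ (inner ℝ (V y) (W y) : ℝ)) x v =
      inner ℝ (leviCivita (𝓡 2) M V x v) (W x) + inner ℝ (V x) (leviCivita (𝓡 2) M W x v) := by
  have := leviCivita_metric (FiberBundle.mdifferentiableAt_extend (𝓡 2) Plane v) hV hW
  rwa [FiberBundle.extend_apply_self] at this

namespace IsFrameOn

variable (h : IsFrameOn e₁ e₂ U) (hx : x ∈ U)
include h hx

theorem connForm_apply (v : TangentSpace (𝓡 2) x) :
    connForm e₁ e₂ x v = (inner ℝ v (e₁ x) : ℝ) * connFst e₁ e₂ x +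
      (inner ℝ v (e₂ x) : ℝ) * connSnd e₁ e₂ x := by
  conv_lhs => rw [h.eq_inner_smul_add hx v]
  simp only [connForm, connFst, connSnd, map_add, map_smul, inner_add_left, real_inner_smul_left]

/-- The component of `∇_v e₁` along `e₁` vanishes, as `e₁` has constant length. -/
theorem leviCivita_fst (v : TangentSpace (𝓡 2) x) :
    leviCivita (𝓡 2) M e₁ x v = connForm e₁ e₂ x v • e₂ x := by
  have h1 := (h.smooth₁ x hx).diffFieldAt
  have hm := mvfderiv_inner h1 h1 v
  have hc : (fun y ↦ (inner ℝ (e₁ y) (e₁ y) : ℝ)) =ᶠ[𝓝 x] fun _ ↦ 1 := by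
    filter_upwards [h.isOpen.mem_nhds hx] with y hy using h.inner₁₁ y hy
  have h0 : mvfderiv (𝓡 2) (fun y ↦ (inner ℝ (e₁ y) (e₁ y) : ℝ)) x v = 0 := by
    have := (dirDeriv_congr (V := FiberBundle.extend Plane v) hc).trans (dirDeriv_const 1)
    rwa [dirDeriv, FiberBundle.extend_apply_self] at this
  rw [h0, real_inner_comm _ (e₁ x)] at hm
  rw [h.eq_inner_smul_add hx (leviCivita (𝓡 2) M e₁ x v),
    show (inner ℝ (leviCivita (𝓡 2) M e₁ x v) (e₁ x) : ℝ) = 0 by linarith, zero_smul, zero_add]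
  rfl

/-- The form `⟨∇_v e₂, e₁⟩` is the negative of the connection form, as `⟨e₁, e₂⟩` is constant. -/
theorem leviCivita_snd (v : TangentSpace (𝓡 2) x) :
    leviCivita (𝓡 2) M e₂ x v = -connForm e₁ e₂ x v • e₁ x := by
  have h1 := (h.smooth₁ x hx).diffFieldAt
  have h2 := (h.smooth₂ x hx).diffFieldAt
  have hm := mvfderiv_inner h2 h2 v
  have hm' := mvfderiv_inner h1 h2 v
  have hc : (fun y ↦ (inner ℝ (e₂ y) (e₂ y) : ℝ)) =ᶠ[𝓝 x] fun _ ↦ 1 := by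
    filter_upwards [h.isOpen.mem_nhds hx] with y hy using h.inner₂₂ y hy
  have hc' : (fun y ↦ (inner ℝ (e₁ y) (e₂ y) : ℝ)) =ᶠ[𝓝 x] fun _ ↦ 0 := by
    filter_upwards [h.isOpen.mem_nhds hx] with y hy using h.inner₁₂ y hy
  have h0 : mvfderiv (𝓡 2) (fun y ↦ (inner ℝ (e₂ y) (e₂ y) : ℝ)) x v = 0 := by
    have := (dirDeriv_congr (V := FiberBundle.extend Plane v) hc).trans (dirDeriv_const 1)
    rwa [dirDeriv, FiberBundle.extend_apply_self] at this
  have h0' : mvfderiv (𝓡 2) (fun y ↦ (inner ℝ (e₁ y) (e₂ y) : ℝ)) x v = 0 := by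
    have := (dirDeriv_congr (V := FiberBundle.extend Plane v) hc').trans (dirDeriv_const 0)
    rwa [dirDeriv, FiberBundle.extend_apply_self] at this
  rw [h0, real_inner_comm _ (e₂ x)] at hm
  rw [h0', real_inner_comm _ (e₁ x)] at hm'
  rw [h.eq_inner_smul_add hx (leviCivita (𝓡 2) M e₂ x v),
    show (inner ℝ (leviCivita (𝓡 2) M e₂ x v) (e₂ x) : ℝ) = 0 by linarith, zero_smul, add_zero,
    show (inner ℝ (leviCivita (𝓡 2) M e₂ x v) (e₁ x) : ℝ) = -connForm e₁ e₂ x v by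
      simp only [connForm]; linarith]

/-- Torsion-freeness, in terms of the connection coefficients. -/
theorem mlieBracket_eq :
    VectorField.mlieBracket (𝓡 2) e₁ e₂ x =
      -connFst e₁ e₂ x • e₁ x - connSnd e₁ e₂ x • e₂ x := by
  rw [← leviCivita_sub_swap (h.smooth₁ x hx).diffFieldAt (h.smooth₂ x hx).diffFieldAt,
    h.leviCivita_fst hx, h.leviCivita_snd hx]
  rfl

/-- Up to sign, the connection coefficients are the components of the smooth field `[e₁, e₂]`. -/
theorem smoothFunAt_connFst : SmoothFunAt (connFst e₁ e₂) x := by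
  refine (smoothFunAt_inner (smoothFieldAt_mlieBracket (h.smooth₁ x hx) (h.smooth₂ x hx))
    (h.smooth₁ x hx)).neg.congr_of_eventuallyEq ?_
  filter_upwards [h.isOpen.mem_nhds hx] with y hy
  simp [-inner_self_eq_norm_sq_to_K, h.mlieBracket_eq hy, inner_sub_left,
    real_inner_smul_left, h.inner₁₁ y hy, real_inner_comm (e₁ y) (e₂ y), h.inner₁₂ y hy]

theorem smoothFunAt_connSnd : SmoothFunAt (connSnd e₁ e₂) x := by
  refine (smoothFunAt_inner (smoothFieldAt_mlieBracket (h.smooth₁ x hx) (h.smooth₂ x hx))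
    (h.smooth₂ x hx)).neg.congr_of_eventuallyEq ?_
  filter_upwards [h.isOpen.mem_nhds hx] with y hy
  simp [-inner_self_eq_norm_sq_to_K, h.mlieBracket_eq hy, inner_sub_left,
    real_inner_smul_left, h.inner₂₂ y hy, h.inner₁₂ y hy]

/-- The covariant derivative of a vector field in terms of its components in a frame. -/
theorem leviCivita_of_eventuallyEq (hV : DiffFieldAt V x) (hp : DiffFunAt p x)
    (hq : DiffFunAt q x) (hVpq : V =ᶠ[𝓝 x] fun y ↦ p y • e₁ y + q y • e₂ y)
    (v : TangentSpace (𝓡 2) x) :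
    leviCivita (𝓡 2) M V x v = (mvfderiv (𝓡 2) p x v - q x * connForm e₁ e₂ x v) • e₁ x +
      (mvfderiv (𝓡 2) q x v + p x * connForm e₁ e₂ x v) • e₂ x := by
  have h1 := (h.smooth₁ x hx).diffFieldAt
  have h2 := (h.smooth₂ x hx).diffFieldAt
  have hc := (leviCivita (𝓡 2) M).isCovariantDerivativeOnUniv
  have h3 : DiffFieldAt ((p • e₁ : Π x : M, TangentSpace (𝓡 2) x) + q • e₂) x :=
    mdifferentiableAt_add_section (hp.smul_section h1) (hq.smul_section h2)
  rw [leviCivita_congr hV h3 hVpq]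
  refine (congrArg (fun l ↦ l v) ((hc.add (hp.smul_section h1) (hq.smul_section h2)).trans
    (congrArg₂ _ (hc.leibniz h1 hp) (hc.leibniz h2 hq)))).trans ?_
  have e1 := h.leviCivita_fst hx v
  have e2 := h.leviCivita_snd hx v
  change p x • leviCivita (𝓡 2) M e₁ x v + mvfderiv (𝓡 2) p x v • e₁ x +
    (q x • leviCivita (𝓡 2) M e₂ x v + mvfderiv (𝓡 2) q x v • e₂ x) = _
  rw [e1, e2]
  module

end IsFrameOn

namespace IsFrameOn

/-- The curvature tensor of a surface in terms of the connection coefficients of an orthonormal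
frame. -/
theorem inner_curvature (h : IsFrameOn e₁ e₂ U) (hx : x ∈ U) (hV : SmoothFieldAt V x)
    (hW : SmoothFieldAt W x) :
    inner ℝ (curvature V W W x) (V x) =
      (-dirDeriv e₁ (connSnd e₁ e₂) x + dirDeriv e₂ (connFst e₁ e₂) x
        - connFst e₁ e₂ x ^ 2 - connSnd e₁ e₂ x ^ 2) *
      (inner ℝ (V x) (e₁ x) * inner ℝ (W x) (e₂ x) -
        inner ℝ (V x) (e₂ x) * inner ℝ (W x) (e₁ x)) ^ 2 := by
  let v₁ : M → ℝ := fun y ↦ inner ℝ (V y) (e₁ y)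
  let v₂ : M → ℝ := fun y ↦ inner ℝ (V y) (e₂ y)
  let w₁ : M → ℝ := fun y ↦ inner ℝ (W y) (e₁ y)
  let w₂ : M → ℝ := fun y ↦ inner ℝ (W y) (e₂ y)
  set a := connFst e₁ e₂ with ha
  set b := connSnd e₁ e₂ with hb
  have sa : SmoothFunAt a x := h.smoothFunAt_connFst hx
  have sb : SmoothFunAt b x := h.smoothFunAt_connSnd hx
  have sv₁ : SmoothFunAt v₁ x := smoothFunAt_inner hV (h.smooth₁ x hx)
  have sv₂ : SmoothFunAt v₂ x := smoothFunAt_inner hV (h.smooth₂ x hx)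
  have sw₁ : SmoothFunAt w₁ x := smoothFunAt_inner hW (h.smooth₁ x hx)
  have sw₂ : SmoothFunAt w₂ x := smoothFunAt_inner hW (h.smooth₂ x hx)
  have hVe (y) (hy : y ∈ U) : V y = v₁ y • e₁ y + v₂ y • e₂ y := h.eq_inner_smul_add hy _
  have hWe (y) (hy : y ∈ U) : W y = w₁ y • e₁ y + w₂ y • e₂ y := h.eq_inner_smul_add hy _
  have hU : U ∈ 𝓝 x := h.isOpen.mem_nhds hx
  -- the values of the connection form on `V` and `W`
  let oV : M → ℝ := fun y ↦ v₁ y * a y + v₂ y * b y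
  let oW : M → ℝ := fun y ↦ w₁ y * a y + w₂ y * b y
  have soV : SmoothFunAt oV x := (sv₁.mul sa).add (sv₂.mul sb)
  have soW : SmoothFunAt oW x := (sw₁.mul sa).add (sw₂.mul sb)
  have hoV (y) (hy : y ∈ U) : connForm e₁ e₂ y (V y) = oV y := h.connForm_apply hy _
  have hoW (y) (hy : y ∈ U) : connForm e₁ e₂ y (W y) = oW y := h.connForm_apply hy _
  -- the components of `∇_V W` and `∇_W W`
  have hcov (X : Π x : M, TangentSpace (𝓡 2) x) : (fun y ↦ leviCivita (𝓡 2) M W y (X y)) =ᶠ[𝓝 x]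
      fun y ↦ (dirDeriv X w₁ y - w₂ y * connForm e₁ e₂ y (X y)) • e₁ y +
        (dirDeriv X w₂ y + w₁ y * connForm e₁ e₂ y (X y)) • e₂ y := by
    filter_upwards [h.isOpen.mem_nhds hx, eventually_diffFieldAt hW, eventually_diffFunAt sw₁,
      eventually_diffFunAt sw₂] with y hy h1 h2 h3
    refine h.leviCivita_of_eventuallyEq hy h1 h2 h3 ?_ (X y)
    filter_upwards [h.isOpen.mem_nhds hy] with z hz using hWe z hz
  have sA {X : Π x : M, TangentSpace (𝓡 2) x} {o : M → ℝ} (hX : SmoothFieldAt X x)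
      (ho : SmoothFunAt o x) : SmoothFunAt (fun y ↦ dirDeriv X w₁ y + -(w₂ y * o y)) x :=
    (smoothFunAt_dirDeriv hX sw₁).add (sw₂.mul ho).neg
  have sB {X : Π x : M, TangentSpace (𝓡 2) x} {o : M → ℝ} (hX : SmoothFieldAt X x)
      (ho : SmoothFunAt o x) : SmoothFunAt (fun y ↦ dirDeriv X w₂ y + w₁ y * o y) x :=
    (smoothFunAt_dirDeriv hX sw₂).add (sw₁.mul ho)
  have hcov' {X : Π x : M, TangentSpace (𝓡 2) x} {o : M → ℝ}
      (ho : ∀ y ∈ U, connForm e₁ e₂ y (X y) = o y) :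
      (fun y ↦ leviCivita (𝓡 2) M W y (X y)) =ᶠ[𝓝 x]
      fun y ↦ (dirDeriv X w₁ y + -(w₂ y * o y)) • e₁ y + (dirDeriv X w₂ y + w₁ y * o y) • e₂ y := by
    filter_upwards [hcov X, hU] with y h1 h2
    rw [h1, ho y h2, sub_eq_add_neg]
  have scov {X : Π x : M, TangentSpace (𝓡 2) x} {o : M → ℝ} (hX : SmoothFieldAt X x)
      (so : SmoothFunAt o x) (ho : ∀ y ∈ U, connForm e₁ e₂ y (X y) = o y) :
      SmoothFieldAt (fun y ↦ leviCivita (𝓡 2) M W y (X y)) x := by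
    refine (((sA hX so).smul_section (h.smooth₁ x hx)).add_section
      ((sB hX so).smul_section (h.smooth₂ x hx))).congr_of_eventuallyEq ?_
    filter_upwards [hcov' ho] with y hy
    rw [hy]
    rfl
  have hcc {X : Π x : M, TangentSpace (𝓡 2) x} {o : M → ℝ} (hX : SmoothFieldAt X x)
      (so : SmoothFunAt o x) (ho : ∀ y ∈ U, connForm e₁ e₂ y (X y) = o y) (u) :=
    h.leviCivita_of_eventuallyEq hx (scov hX so ho).diffFieldAt (sA hX so).diffFunAt
      (sB hX so).diffFunAt (hcov' ho) u
  have c1 := hcc hW soW hoW (V x)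
  have c2 := hcc hV soV hoV (W x)
  have c3 := h.leviCivita_of_eventuallyEq hx hW.diffFieldAt sw₁.diffFunAt sw₂.diffFunAt
    (by filter_upwards [hU] with z hz using hWe z hz) (VectorField.mlieBracket (𝓡 2) V W x)
  have c4 := h.leviCivita_of_eventuallyEq hx hW.diffFieldAt sw₁.diffFunAt sw₂.diffFunAt
    (by filter_upwards [hU] with z hz using hWe z hz) (V x)
  have c5 := h.leviCivita_of_eventuallyEq hx hV.diffFieldAt sv₁.diffFunAt sv₂.diffFunAt
    (by filter_upwards [hU] with z hz using hVe z hz) (W x)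
  have hbr := leviCivita_sub_swap hV.diffFieldAt hW.diffFieldAt
  have e11 := h.inner₁₁ x hx
  have e12 := h.inner₁₂ x hx
  have e21 : inner ℝ (e₂ x) (e₁ x) = (0 : ℝ) := (real_inner_comm _ _).trans e12
  have e22 := h.inner₂₂ x hx
  have d {X Y : Π x : M, TangentSpace (𝓡 2) x} {o : M → ℝ} (hX : SmoothFieldAt X x)
      (so : SmoothFunAt o x) :
      dirDeriv Y (fun y ↦ dirDeriv X w₁ y + -(w₂ y * o y)) x =
        dirDeriv Y (dirDeriv X w₁) x - (w₂ x * dirDeriv Y o x + o x * dirDeriv Y w₂ x) := by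
    rw [dirDeriv_add (smoothFunAt_dirDeriv hX sw₁).diffFunAt
        (smoothFunAt_neg (smoothFunAt_mul sw₂ so)).diffFunAt,
      dirDeriv_neg, dirDeriv_mul sw₂.diffFunAt so.diffFunAt, sub_eq_add_neg]
  have d' {X Y : Π x : M, TangentSpace (𝓡 2) x} {o : M → ℝ} (hX : SmoothFieldAt X x)
      (so : SmoothFunAt o x) :
      dirDeriv Y (fun y ↦ dirDeriv X w₂ y + w₁ y * o y) x =
        dirDeriv Y (dirDeriv X w₂) x + (w₁ x * dirDeriv Y o x + o x * dirDeriv Y w₁ x) := by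
    rw [dirDeriv_add (smoothFunAt_dirDeriv hX sw₂).diffFunAt (smoothFunAt_mul sw₁ so).diffFunAt,
      dirDeriv_mul sw₁.diffFunAt so.diffFunAt]
  have doV {Y : Π x : M, TangentSpace (𝓡 2) x} : dirDeriv Y oV x =
      v₁ x * dirDeriv Y a x + a x * dirDeriv Y v₁ x +
      (v₂ x * dirDeriv Y b x + b x * dirDeriv Y v₂ x) := by
    rw [dirDeriv_add (smoothFunAt_mul sv₁ sa).diffFunAt (smoothFunAt_mul sv₂ sb).diffFunAt,
      dirDeriv_mul sv₁.diffFunAt sa.diffFunAt, dirDeriv_mul sv₂.diffFunAt sb.diffFunAt]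
  have doW {Y : Π x : M, TangentSpace (𝓡 2) x} : dirDeriv Y oW x =
      w₁ x * dirDeriv Y a x + a x * dirDeriv Y w₁ x +
      (w₂ x * dirDeriv Y b x + b x * dirDeriv Y w₂ x) := by
    rw [dirDeriv_add (smoothFunAt_mul sw₁ sa).diffFunAt (smoothFunAt_mul sw₂ sb).diffFunAt,
      dirDeriv_mul sw₁.diffFunAt sa.diffFunAt, dirDeriv_mul sw₂.diffFunAt sb.diffFunAt]
  have comm {f : M → ℝ} (hf : SmoothFunAt f x) := dirDeriv_mlieBracket hV hW hf
    (smoothFunAt_dirDeriv hV hf).diffFunAt (smoothFunAt_dirDeriv hW hf).diffFunAt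
  have k1 := comm sw₁
  have k2 := comm sw₂
  have hobr : connForm e₁ e₂ x (VectorField.mlieBracket (𝓡 2) V W x) =
      (dirDeriv V w₁ x - w₂ x * oV x - (dirDeriv W v₁ x - v₂ x * oW x)) * a x +
      (dirDeriv V w₂ x + w₁ x * oV x - (dirDeriv W v₂ x + v₁ x * oW x)) * b x := by
    rw [h.connForm_apply hx, ← hbr, c4, c5, hoV x hx, hoW x hx]
    simp only [inner_sub_left, inner_add_left, real_inner_smul_left, e11, e12, e21, e22]
    simp only [dirDeriv, ← ha, ← hb]
    ring
  have hVa := dirDeriv_eq_of_eq_smul_add (hVe x hx) a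
  have hVb := dirDeriv_eq_of_eq_smul_add (hVe x hx) b
  have hWa := dirDeriv_eq_of_eq_smul_add (hWe x hx) a
  have hWb := dirDeriv_eq_of_eq_smul_add (hWe x hx) b
  rw [curvature, c1, c2, c3, hobr, hoV x hx, hoW x hx]
  change inner ℝ (((dirDeriv V (fun y ↦ dirDeriv W w₁ y + -(w₂ y * oW y)) x -
    (dirDeriv W w₂ x + w₁ x * oW x) * oV x) • e₁ x +
    (dirDeriv V (fun y ↦ dirDeriv W w₂ y + w₁ y * oW y) x +
      (dirDeriv W w₁ x + -(w₂ x * oW x)) * oV x) • e₂ x) -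
    ((dirDeriv W (fun y ↦ dirDeriv V w₁ y + -(w₂ y * oV y)) x -
    (dirDeriv V w₂ x + w₁ x * oV x) * oW x) • e₁ x +
    (dirDeriv W (fun y ↦ dirDeriv V w₂ y + w₁ y * oV y) x +
      (dirDeriv V w₁ x + -(w₂ x * oV x)) * oW x) • e₂ x) -
    ((dirDeriv (VectorField.mlieBracket (𝓡 2) V W) w₁ x - w₂ x * _) • e₁ x +
    (dirDeriv (VectorField.mlieBracket (𝓡 2) V W) w₂ x + w₁ x * _) • e₂ x)) (V x) =
    (_ - a x ^ 2 - b x ^ 2) * (v₁ x * w₂ x - v₂ x * w₁ x) ^ 2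
  rw [k1, k2, d hW soW, d hV soV, d' hW soW, d' hV soV, doV, doW, hVe x hx, hVa, hVb, hWa, hWb]
  simp only [inner_sub_left, inner_add_left, inner_add_right, real_inner_smul_left,
    real_inner_smul_right, e11, e12, e21, e22]
  simp only [oV, oW]
  ring

end IsFrameOn
end Frame

/-! ### Gradient and Gaussian curvature -/

section Gradient

variable {M : Type*} [TopologicalSpace M] [ChartedSpace Plane M]
  [RiemannianBundle (fun x : M ↦ TangentSpace (𝓡 2) x)]
  {V : Π x : M, TangentSpace (𝓡 2) x} {x : M}

/-- The unit vector field in the direction of `V`. -/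
def unitField (V : Π x : M, TangentSpace (𝓡 2) x) (x : M) : TangentSpace (𝓡 2) x :=
  ‖V x‖⁻¹ • V x

theorem inner_unitField_self (h0 : V x ≠ 0) :
    inner ℝ (unitField V x) (unitField V x) = (1 : ℝ) := by
  rw [unitField, real_inner_smul_left, real_inner_smul_right, real_inner_self_eq_norm_sq]
  have := norm_ne_zero_iff.2 h0
  field_simp

theorem inner_gradient (f : M → ℝ) (x : M) (v : TangentSpace (𝓡 2) x) :
    inner ℝ (gradient (𝓡 2) f x) v = mvfderiv (𝓡 2) f x v := inner_sharp x _ v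

end Gradient

section Curvature

variable {M : Type*} [TopologicalSpace M] [ChartedSpace Plane M]
  [IsManifold (𝓡 2) ∞ M] [RiemannianBundle (fun x : M ↦ TangentSpace (𝓡 2) x)]
  {e₁ e₂ V W : Π x : M, TangentSpace (𝓡 2) x} {U : Set M} {x : M}

theorem IsFrameOn.inner_eq (h : IsFrameOn e₁ e₂ U) (hx : x ∈ U) (v w : TangentSpace (𝓡 2) x) :
    inner ℝ v w =
      (inner ℝ v (e₁ x) * inner ℝ w (e₁ x) + inner ℝ v (e₂ x) * inner ℝ w (e₂ x) : ℝ) := by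
  conv_lhs => rw [h.eq_inner_smul_add hx v]
  rw [inner_add_left, real_inner_smul_left, real_inner_smul_left, real_inner_comm w (e₁ x),
    real_inner_comm w (e₂ x)]

/-- The determinant of two independent vectors in an orthonormal frame is not zero. -/
theorem IsFrameOn.det_ne_zero (h : IsFrameOn e₁ e₂ U) (hx : x ∈ U) {v w : TangentSpace (𝓡 2) x}
    (hvw : LinearIndependent ℝ ![v, w]) :
    inner ℝ v (e₁ x) * inner ℝ w (e₂ x) - inner ℝ v (e₂ x) * inner ℝ w (e₁ x) ≠ (0 : ℝ) := by
  intro h0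
  rw [LinearIndependent.pair_iff] at hvw
  have hv := h.eq_inner_smul_add hx v
  have hw := h.eq_inner_smul_add hx w
  set v₁ : ℝ := inner ℝ v (e₁ x)
  set v₂ : ℝ := inner ℝ v (e₂ x)
  set w₁ : ℝ := inner ℝ w (e₁ x)
  set w₂ : ℝ := inner ℝ w (e₂ x)
  have k1 := hvw w₁ (-v₁) (by
    rw [hv, hw]
    trans (-(v₁ * w₂ - v₂ * w₁)) • e₂ x
    · module
    · rw [h0, neg_zero, zero_smul])
  have k2 := hvw w₂ (-v₂) (by
    rw [hv, hw]
    trans (v₁ * w₂ - v₂ * w₁) • e₁ x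
    · module
    · rw [h0, zero_smul])
  have k3 := hvw 1 0 (by rw [hv, neg_eq_zero.1 k1.2, neg_eq_zero.1 k2.2]; simp)
  exact one_ne_zero k3.1

/-- The components of the gradient are the derivatives along the frame. -/
theorem IsFrameOn.gradient_eq (h : IsFrameOn e₁ e₂ U) (hx : x ∈ U) (f : M → ℝ) :
    gradient (𝓡 2) f x = dirDeriv e₁ f x • e₁ x + dirDeriv e₂ f x • e₂ x := by
  rw [h.eq_inner_smul_add hx (gradient (𝓡 2) f x), inner_gradient, inner_gradient]
  rfl

variable [IsContMDiffRiemannianBundle (𝓡 2) ∞ Plane (fun x : M ↦ TangentSpace (𝓡 2) x)]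

/-- The Gaussian curvature in terms of the connection coefficients of an orthonormal frame. -/
theorem IsFrameOn.gaussCurvature_eq (h : IsFrameOn e₁ e₂ U) (hx : x ∈ U) :
    gaussCurvature M x = -dirDeriv e₁ (connSnd e₁ e₂) x + dirDeriv e₂ (connFst e₁ e₂) x
        - connFst e₁ e₂ x ^ 2 - connSnd e₁ e₂ x ^ 2 := by
  have hV : SmoothFieldAt (FiberBundle.extend Plane (tangentBasis x 0)) x :=
    FiberBundle.contMDiffAt_extend (𝓡 2) Plane _
  have hW : SmoothFieldAt (FiberBundle.extend Plane (tangentBasis x 1)) x :=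
    FiberBundle.contMDiffAt_extend (𝓡 2) Plane _
  have hc := h.inner_curvature hx hV hW
  simp only [FiberBundle.extend_apply_self] at hc
  have hli : LinearIndependent ℝ ![tangentBasis x 0, tangentBasis x 1] := by
    convert (tangentBasis x).linearIndependent using 1
    ext i
    fin_cases i <;> rfl
  have hd := h.det_ne_zero hx hli
  have g₀₀ := h.inner_eq hx (tangentBasis x 0) (tangentBasis x 0)
  have g₀₁ := h.inner_eq hx (tangentBasis x 0) (tangentBasis x 1)
  have g₁₁ := h.inner_eq hx (tangentBasis x 1) (tangentBasis x 1)
  rw [gaussCurvature, sectionalCurvature, hc, g₀₀, g₀₁, g₁₁, div_eq_iff]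
  · ring
  · refine ne_of_eq_of_ne ?_ (pow_ne_zero 2 hd)
    ring

theorem smoothFieldAt_unitField (hV : SmoothFieldAt V x) (h0 : V x ≠ 0) :
    SmoothFieldAt (unitField V) x := by
  have h1 : SmoothFunAt (fun y ↦ (Real.sqrt (inner ℝ (V y) (V y)))⁻¹) x := by
    have h2 : (inner ℝ (V x) (V x) : ℝ) ≠ 0 := inner_self_ne_zero.2 h0
    refine smoothFunAt_comp_real (φ := fun t ↦ (Real.sqrt t)⁻¹) ?_ (smoothFunAt_inner hV hV)
    exact (Real.contDiffAt_sqrt h2).inv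
      (Real.sqrt_ne_zero'.2 (lt_of_le_of_ne real_inner_self_nonneg h2.symm))
  have h3 : (fun y ↦ (Real.sqrt (inner ℝ (V y) (V y)))⁻¹) = fun y ↦ ‖V y‖⁻¹ := by
    ext y
    rw [norm_eq_sqrt_real_inner]
  rw [h3] at h1
  exact h1.smul_section hV

/-- Smooth orthonormal frames exist near every point, by the Gram-Schmidt process. -/
theorem exists_isFrameOn (x : M) :
    ∃ (e₁ e₂ : Π y : M, TangentSpace (𝓡 2) y) (U : Set M), x ∈ U ∧ IsFrameOn e₁ e₂ U := by
  let V : Π y : M, TangentSpace (𝓡 2) y := FiberBundle.extend Plane (tangentBasis x 0)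
  let W : Π y : M, TangentSpace (𝓡 2) y := FiberBundle.extend Plane (tangentBasis x 1)
  have hVx : V x = tangentBasis x 0 := FiberBundle.extend_apply_self ..
  have hWx : W x = tangentBasis x 1 := FiberBundle.extend_apply_self ..
  obtain ⟨s, hs, hsV⟩ := FiberBundle.exists_contMDiffOn_extend (k := ∞) (𝓡 2) Plane
    (tangentBasis x 0)
  obtain ⟨t, ht, htW⟩ := FiberBundle.exists_contMDiffOn_extend (k := ∞) (𝓡 2) Plane
    (tangentBasis x 1)
  let e₁ := unitField V
  let W' : Π y : M, TangentSpace (𝓡 2) y := W - fun y ↦ (inner ℝ (W y) (e₁ y) : ℝ) • e₁ y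
  have hVs (y) (hy : y ∈ interior s) : SmoothFieldAt V y :=
    (hsV y (interior_subset hy)).contMDiffAt (mem_interior_iff_mem_nhds.1 hy)
  have hWs (y) (hy : y ∈ interior t) : SmoothFieldAt W y :=
    (htW y (interior_subset hy)).contMDiffAt (mem_interior_iff_mem_nhds.1 hy)
  have hV0 : V x ≠ 0 := by rw [hVx]; exact (tangentBasis x).ne_zero 0
  have e₁s (y) (hy : y ∈ interior s) (h0 : V y ≠ 0) : SmoothFieldAt e₁ y :=
    smoothFieldAt_unitField (hVs y hy) h0
  have W's (y) (hy : y ∈ interior s) (hy' : y ∈ interior t) (h0 : V y ≠ 0) :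
      SmoothFieldAt W' y :=
    (hWs y hy').sub_section
      ((smoothFunAt_inner (hWs y hy') (e₁s y hy h0)).smul_section (e₁s y hy h0))
  have hxs : x ∈ interior s := mem_interior_iff_mem_nhds.2 hs
  have hxt : x ∈ interior t := mem_interior_iff_mem_nhds.2 ht
  have hW0 : W' x ≠ 0 := by
    intro h0
    have hli : LinearIndependent ℝ ![tangentBasis x 0, tangentBasis x 1] := by
      convert (tangentBasis x).linearIndependent using 1
      ext i
      fin_cases i <;> rfl
    rw [LinearIndependent.pair_iff] at hli
    have h1 : W x - (inner ℝ (W x) (e₁ x) : ℝ) • (‖V x‖⁻¹ • V x) = 0 := h0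
    have := hli (-(inner ℝ (W x) (e₁ x) : ℝ) * ‖V x‖⁻¹) 1 (by
      rw [← hVx, ← hWx, ← h1]
      module)
    exact one_ne_zero this.2
  have hne {Z : Π y : M, TangentSpace (𝓡 2) y} {y : M} (hZ : SmoothFieldAt Z y) (h0 : Z y ≠ 0) :
      ∀ᶠ z in 𝓝 y, Z z ≠ 0 := by
    filter_upwards [(smoothFunAt_inner hZ hZ).continuousAt.eventually_ne
      (inner_self_ne_zero.2 h0 : (inner ℝ (Z y) (Z y) : ℝ) ≠ 0)] with z hz
    exact inner_self_ne_zero.1 hz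
  refine ⟨e₁, unitField W', {y | y ∈ interior s ∧ y ∈ interior t ∧ V y ≠ 0 ∧ W' y ≠ 0},
    ⟨hxs, hxt, hV0, hW0⟩, ?_, fun y hy ↦ e₁s y hy.1 hy.2.2.1,
    fun y hy ↦ smoothFieldAt_unitField (W's y hy.1 hy.2.1 hy.2.2.1) hy.2.2.2,
    fun y hy ↦ inner_unitField_self hy.2.2.1, fun y hy ↦ ?_,
    fun y hy ↦ inner_unitField_self hy.2.2.2⟩
  · rw [isOpen_iff_mem_nhds]
    rintro y ⟨h1, h2, h3, h4⟩
    filter_upwards [isOpen_interior.mem_nhds h1, isOpen_interior.mem_nhds h2, hne (hVs y h1) h3,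
      hne (W's y h1 h2 h3) h4] with z k1 k2 k3 k4 using ⟨k1, k2, k3, k4⟩
  · have h1 : inner ℝ (e₁ y) (e₁ y) = (1 : ℝ) := inner_unitField_self hy.2.2.1
    have h2 : inner ℝ (e₁ y) (W' y) = (0 : ℝ) := by
      change inner ℝ (e₁ y) (W y - (inner ℝ (W y) (e₁ y) : ℝ) • e₁ y) = (0 : ℝ)
      rw [inner_sub_right, real_inner_smul_right, h1, real_inner_comm (e₁ y)]
      ring
    rw [unitField, real_inner_smul_right, h2, mul_zero]

theorem smoothFunAt_gaussCurvature (x : M) : SmoothFunAt (gaussCurvature M) x := by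
  obtain ⟨e₁, e₂, U, hx, h⟩ := exists_isFrameOn x
  have ha := h.smoothFunAt_connFst hx
  have hb := h.smoothFunAt_connSnd hx
  have := (((smoothFunAt_neg (smoothFunAt_dirDeriv (h.smooth₁ x hx) hb)).add
    (smoothFunAt_dirDeriv (h.smooth₂ x hx) ha)).sub (ha.pow 2)).sub (hb.pow 2)
  refine this.congr_of_eventuallyEq ?_
  filter_upwards [h.isOpen.mem_nhds hx] with y hy
  exact h.gaussCurvature_eq hy

theorem smoothFieldAt_gradient {f : M → ℝ} (hf : SmoothFunAt f x) :
    SmoothFieldAt (gradient (𝓡 2) f) x := by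
  obtain ⟨e₁, e₂, U, hx, h⟩ := exists_isFrameOn x
  have h1 := h.smooth₁ x hx
  have h2 := h.smooth₂ x hx
  refine (((smoothFunAt_dirDeriv h1 hf).smul_section h1).add_section
    ((smoothFunAt_dirDeriv h2 hf).smul_section h2)).congr_of_eventuallyEq ?_
  filter_upwards [h.isOpen.mem_nhds hx] with y hy
  rw [h.gradient_eq hy]
  rfl

end Curvature

/-! ### Coordinate vector fields of a chart -/

section ChartField

theorem tangentBasis_eq_single {M : Type*} [TopologicalSpace M] [ChartedSpace Plane M] (x : M)
    (i : Fin 2) : (tangentBasis x i : Plane) = EuclideanSpace.single i 1 := by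
  exact (congrFun (EuclideanSpace.basisFun (Fin 2) ℝ).coe_toBasis i).trans
    (EuclideanSpace.basisFun_apply (Fin 2) ℝ i)

/-- On the plane, the Lie bracket of vector fields is given by the usual formula. -/
theorem mlieBracket_plane (V W : Plane → Plane) (q : Plane) :
    (VectorField.mlieBracket (𝓡 2) (M := Plane) V W q : Plane) =
      fderiv ℝ W q (V q) - fderiv ℝ V q (W q) := by
  have h := congrFun (VectorField.mlieBracketWithin_eq_lieBracketWithin (𝕜 := ℝ) (V := V) (W := W)
    (s := univ)) q
  rw [VectorField.lieBracketWithin_univ] at h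
  exact (congrFun VectorField.mlieBracketWithin_univ q).symm.trans h

theorem smoothFieldAt_tangentBasis (q : Plane) (i : Fin 2) :
    SmoothFieldAt (M := Plane) (fun q ↦ tangentBasis q i) q :=
  contMDiffAt_vectorSpace_iff_contDiffAt.2 contDiffAt_const

variable {M : Type*} [TopologicalSpace M] [ChartedSpace Plane M]
  {φ : OpenPartialHomeomorph M Plane} {x : M}

/-- The coordinate vector field `∂/∂xᵢ` of a chart, as a vector field on the surface. It is the
zero field where the chart has no invertible derivative, in particular it is only meaningful on the
domain of the chart. -/
def chartField (φ : OpenPartialHomeomorph M Plane) (i : Fin 2) (x : M) : TangentSpace (𝓡 2) x :=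
  VectorField.mpullback (𝓡 2) (𝓡 2) φ (fun q ↦ tangentBasis q i) x

theorem mdifferentiable_of_mem_maximalAtlas (hφ : φ ∈ IsManifold.maximalAtlas (𝓡 2) ∞ M) :
    φ.MDifferentiable (𝓡 2) (𝓡 2) :=
  ⟨(contMDiffOn_of_mem_maximalAtlas hφ).mdifferentiableOn (by simp),
    (contMDiffOn_symm_of_mem_maximalAtlas hφ).mdifferentiableOn (by simp)⟩

theorem isInvertible_mfderiv_of_mem_maximalAtlas
    (hφ : φ ∈ IsManifold.maximalAtlas (𝓡 2) ∞ M) (hx : x ∈ φ.source) :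
    (mfderiv (𝓡 2) (𝓡 2) φ x).IsInvertible :=
  ⟨(mdifferentiable_of_mem_maximalAtlas hφ).mfderiv hx, rfl⟩

variable (hφ : φ ∈ IsManifold.maximalAtlas (𝓡 2) ∞ M)
include hφ

theorem mfderiv_chartField (hx : x ∈ φ.source) (i : Fin 2) :
    mfderiv (𝓡 2) (𝓡 2) φ x (chartField φ i x) = tangentBasis (φ x) i :=
  (isInvertible_mfderiv_of_mem_maximalAtlas hφ hx).self_apply_inverse _

theorem coordVec_eq_chartField {q : Plane} (hq : q ∈ φ.target) (i : Fin 2) :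
    coordVec φ q i = chartField φ i (φ.symm q) := by
  have h1 := (mdifferentiable_of_mem_maximalAtlas hφ).comp_symm_deriv hq
  have h2 := isInvertible_mfderiv_of_mem_maximalAtlas hφ (φ.map_target hq)
  have h3 : mfderiv (𝓡 2) (𝓡 2) φ (φ.symm q) (coordVec φ q i) = tangentBasis q i :=
    congrArg (fun l ↦ l (tangentBasis q i)) h1
  exact (h2.inverse_apply_self _).symm.trans
    (congrArg (mfderiv (𝓡 2) (𝓡 2) φ (φ.symm q)).inverse h3)

theorem dirDeriv_chartField_comp (hx : x ∈ φ.source) {g : Plane → ℝ}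
    (hg : DifferentiableAt ℝ g (φ x)) (i : Fin 2) :
    dirDeriv (chartField φ i) (fun y ↦ g (φ y)) x =
      fderiv ℝ g (φ x) (EuclideanSpace.single i 1) := by
  have := mvfderiv_comp_apply (I := 𝓡 2) (I' := 𝓡 2) x hg.mdifferentiableAt
    ((contMDiffAt_of_mem_maximalAtlas hφ hx).mdifferentiableAt (by simp)) (chartField φ i x)
  rw [mfderiv_chartField hφ hx] at this
  refine this.trans ?_
  rw [mvfderiv, mfderiv_eq_fderiv, ← tangentBasis_eq_single (φ x) i]
  rfl

variable [IsManifold (𝓡 2) ∞ M]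

theorem smoothFieldAt_chartField (hx : x ∈ φ.source) (i : Fin 2) :
    SmoothFieldAt (chartField φ i) x := by
  have hc := smoothFieldAt_tangentBasis (φ x) i
  exact ContMDiffAt.mpullback_vectorField_preimage (n := ∞) hc
    (contMDiffAt_of_mem_maximalAtlas hφ hx) (isInvertible_mfderiv_of_mem_maximalAtlas hφ hx)
    (by simp)

theorem mlieBracket_chartField (hx : x ∈ φ.source) :
    VectorField.mlieBracket (𝓡 2) (chartField φ 0) (chartField φ 1) x = 0 := by
  have : IsManifold (𝓡 2) (minSmoothness ℝ 2) M := by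
    simp only [minSmoothness_of_isRCLikeNormedField]
    infer_instance
  have h := VectorField.mpullback_mlieBracket (n := ∞)
    (smoothFieldAt_tangentBasis (φ x) 0).diffFieldAt
    (smoothFieldAt_tangentBasis (φ x) 1).diffFieldAt (contMDiffAt_of_mem_maximalAtlas hφ hx)
    (by simp only [minSmoothness_of_isRCLikeNormedField]; exact ENat.LEInfty.out)
  refine h.symm.trans ?_
  have h0 : VectorField.mlieBracket (𝓡 2) (M := Plane) (fun q ↦ tangentBasis q 0)
      (fun q ↦ tangentBasis q 1) = 0 := by
    ext1 q
    refine (mlieBracket_plane _ _ q).trans ?_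
    have h1 (w v : Plane) : fderiv ℝ (fun _ : Plane ↦ w) q v = 0 := by simp
    exact (congrArg₂ (fun a b : Plane ↦ a - b) (h1 _ _) (h1 _ _)).trans (sub_zero _)
  rw [h0, VectorField.mpullback_zero]
  rfl

end ChartField

/-! ### Positive bases of an oriented plane -/

section PositiveBasis

variable {V : Type*} [AddCommGroup V] [Module ℝ V] {o : Orientation ℝ V (Fin 2)} {v w : V}

/-- Rescaling a basis by units, written with real factors. -/
theorem unitsSMul_basis_eq (b : Module.Basis (Fin 2) ℝ V) (hb : ⇑b = ![v, w]) (s t : ℝˣ) :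
    ⇑(b.unitsSMul ![s, t]) = ![(s : ℝ) • v, (t : ℝ) • w] := by
  ext i
  rw [Module.Basis.unitsSMul_apply, hb]
  fin_cases i <;> rfl

theorem IsPositiveBasis.smul_smul (h : IsPositiveBasis o ![v, w]) {s t : ℝ} (hst : 0 < s * t) :
    IsPositiveBasis o ![s • v, t • w] := by
  obtain ⟨b, hb, rfl⟩ := h
  have hs : s ≠ 0 := left_ne_zero_of_mul hst.ne'
  have ht : t ≠ 0 := right_ne_zero_of_mul hst.ne'
  refine ⟨b.unitsSMul ![Units.mk0 s hs, Units.mk0 t ht], unitsSMul_basis_eq b hb _ _, ?_⟩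
  rw [Module.Basis.orientation_unitsSMul]
  refine Module.Ray.units_smul_of_pos _ ?_ _
  have h := inv_pos.2 hst
  rw [mul_inv_rev] at h
  simpa using h

theorem IsPositiveBasis.not_neg (h : IsPositiveBasis o ![v, w]) :
    ¬ IsPositiveBasis o ![v, -w] := by
  obtain ⟨b, hb, rfl⟩ := h
  rintro ⟨b', hb', hbb⟩
  have h1 : b' = b.unitsSMul ![1, -1] := by
    apply Module.Basis.eq_of_apply_eq
    intro i
    rw [unitsSMul_basis_eq b hb, hb']
    fin_cases i <;> simp
  rw [h1, Module.Basis.orientation_unitsSMul] at hbb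
  have h2 : (∏ i, (![1, -1] : Fin 2 → ℝˣ) i)⁻¹ • b.orientation = -b.orientation :=
    Module.Ray.units_smul_of_neg _ (by simp) _
  exact Module.Ray.ne_neg_self b.orientation (hbb.symm.trans h2)

end PositiveBasis

section PositiveBasis

variable {V : Type*} [NormedAddCommGroup V] [InnerProductSpace ℝ V]
  {o : Orientation ℝ V (Fin 2)} {e v w : V}

theorem orthonormal_pair_iff : Orthonormal ℝ ![v, w] ↔
    inner ℝ v v = (1 : ℝ) ∧ inner ℝ v w = (0 : ℝ) ∧ inner ℝ w w = (1 : ℝ) := by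
  rw [orthonormal_iff_ite]
  constructor
  · intro h
    exact ⟨h 0 0, h 0 1, h 1 1⟩
  · rintro ⟨h₁, h₂, h₃⟩ i j
    fin_cases i <;> fin_cases j <;>
      simp [h₁, h₂, h₃, real_inner_comm v w, -inner_self_eq_norm_sq_to_K]

/-- In an oriented Euclidean plane, a unit vector is completed to a positive orthonormal basis in
exactly one way. -/
theorem eq_of_positive_orthonormal (hV : Module.finrank ℝ V = 2)
    (h₁ : Orthonormal ℝ ![e, v]) (h₂ : Orthonormal ℝ ![e, w])
    (hv : IsPositiveBasis o ![e, v]) (hw : IsPositiveBasis o ![e, w]) : v = w := by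
  rw [orthonormal_pair_iff] at h₁ h₂
  have h := eq_inner_smul_add_of_orthonormal hV h₂.1 h₂.2.1 h₂.2.2 v
  rw [real_inner_comm, h₁.2.1, zero_smul, zero_add] at h
  have h3 := h₁.2.2
  rw [h, real_inner_smul_left, real_inner_smul_right, h₂.2.2, mul_one] at h3
  rcases mul_self_eq_one_iff.1 h3 with h4 | h4
  · rw [h, h4, one_smul]
  · rw [h4, neg_one_smul] at h
    rw [h] at hv
    exact absurd hv hw.not_neg

end PositiveBasis

/-! ### Special charts and functions of the first coordinate -/

section SpecialChart

theorem isOpen_image_fst {s : Set Plane} (hs : IsOpen s) : IsOpen ((fun q : Plane ↦ q 0) '' s) :=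
  (EuclideanSpace.proj (𝕜 := ℝ) (0 : Fin 2)).isOpenMap
    (fun t ↦ ⟨EuclideanSpace.single 0 t, by simp⟩) s hs

variable {M : Type*} [TopologicalSpace M] [ChartedSpace Plane M]
  {φ : OpenPartialHomeomorph M Plane} {x : M} {g : ℝ → ℝ}

section Coordinate

variable (hφ : φ ∈ IsManifold.maximalAtlas (𝓡 2) ∞ M) (hx : x ∈ φ.source)
include hφ hx

theorem dirDeriv_chartField_fst {g' : ℝ} (hg : HasDerivAt g g' (φ x 0)) (i : Fin 2) :
    dirDeriv (chartField φ i) (fun y ↦ g (φ y 0)) x =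
      g' * EuclideanSpace.single i (1 : ℝ) (0 : Fin 2) := by
  have h1 : HasFDerivAt (fun q : Plane ↦ q 0) (EuclideanSpace.proj (𝕜 := ℝ) (0 : Fin 2)) (φ x) :=
    (EuclideanSpace.proj (𝕜 := ℝ) (0 : Fin 2)).hasFDerivAt
  have h2 := hg.comp_hasFDerivAt (φ x) h1
  have h3 := dirDeriv_chartField_comp hφ hx (g := fun q ↦ g (q 0)) h2.differentiableAt i
  rw [h3]
  exact (DFunLike.congr_fun h2.fderiv _).trans (by simp)

theorem dirDeriv_chartField_zero_fst {g' : ℝ} (hg : HasDerivAt g g' (φ x 0)) :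
    dirDeriv (chartField φ 0) (fun y ↦ g (φ y 0)) x = g' := by
  simp [dirDeriv_chartField_fst hφ hx hg 0]

theorem dirDeriv_chartField_one_fst {g' : ℝ} (hg : HasDerivAt g g' (φ x 0)) :
    dirDeriv (chartField φ 1) (fun y ↦ g (φ y 0)) x = 0 := by
  simp [dirDeriv_chartField_fst hφ hx hg 1]

theorem smoothFunAt_fst (hg : ContDiffAt ℝ ∞ g (φ x 0)) :
    SmoothFunAt (fun y ↦ g (φ y 0)) x := by
  have h1 : ContDiffAt ℝ ∞ (fun q : Plane ↦ q 0) (φ x) :=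
    (EuclideanSpace.proj (𝕜 := ℝ) (0 : Fin 2)).contDiff.contDiffAt
  exact (hg.comp (φ x) h1).contMDiffAt.comp x (contMDiffAt_of_mem_maximalAtlas hφ hx)

end Coordinate

variable [RiemannianBundle (fun x : M ↦ TangentSpace (𝓡 2) x)]
  {o : SurfaceOrientation M} {c : ℝ} {f : ℝ → ℝ}

namespace IsSpecialChart

variable (h : IsSpecialChart o c φ f)
include h

theorem contDiffAt (hx : x ∈ φ.source) : ContDiffAt ℝ ∞ f (φ x 0) :=
  h.smooth.contDiffAt ((isOpen_image_fst φ.open_target).mem_nhds ⟨_, φ.map_source hx, rfl⟩)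

theorem pos' (hx : x ∈ φ.source) : 0 < f (φ x 0) := h.pos _ ⟨_, φ.map_source hx, rfl⟩

theorem hasDerivAt (hx : x ∈ φ.source) : HasDerivAt f (deriv f (φ x 0)) (φ x 0) :=
  ((h.contDiffAt hx).differentiableAt (by simp)).hasDerivAt

theorem contDiffAt_deriv (hx : x ∈ φ.source) : ContDiffAt ℝ ∞ (deriv f) (φ x 0) :=
  have hD := isOpen_image_fst φ.open_target
  ((contDiffOn_infty_iff_deriv_of_isOpen hD).1 h.smooth).2.contDiffAt
    (hD.mem_nhds ⟨_, φ.map_source hx, rfl⟩)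

/-- The metric of a special chart, at points of the surface instead of points of the plane. -/
theorem inner_chartField (hx : x ∈ φ.source) :
    inner ℝ (chartField φ 0 x) (chartField φ 0 x) = (1 : ℝ) ∧
    inner ℝ (chartField φ 0 x) (chartField φ 1 x) = (0 : ℝ) ∧
    inner ℝ (chartField φ 1 x) (chartField φ 1 x) = 1 / f (φ x 0) ^ (3 / 2 : ℝ) := by
  have hq := φ.map_source hx
  have h1 := h.metric_uu _ hq
  have h2 := h.metric_uv _ hq
  have h3 := h.metric_vv _ hq
  simp only [coordVec_eq_chartField h.positive.mem_maximalAtlas hq] at h1 h2 h3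
  rw [φ.left_inv hx] at h1 h2 h3
  exact ⟨h1, h2, h3⟩

end IsSpecialChart
end SpecialChart

/-! ### The orthonormal frame of a special chart -/

section SpecialFrame

variable {M : Type*} [TopologicalSpace M] [ChartedSpace Plane M]
  {φ : OpenPartialHomeomorph M Plane} {f : ℝ → ℝ} {x : M}

/-- The unit vector field `-∂/∂u` of a special chart. -/
def specialFst (φ : OpenPartialHomeomorph M Plane) (x : M) : TangentSpace (𝓡 2) x :=
  (-1 : ℝ) • chartField φ 0 x

/-- The unit vector field `-f(u)^(3/4) ∂/∂v` of a special chart. -/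
def specialSnd (φ : OpenPartialHomeomorph M Plane) (f : ℝ → ℝ) (x : M) : TangentSpace (𝓡 2) x :=
  (-f (φ x 0) ^ (3 / 4 : ℝ)) • chartField φ 1 x

theorem dirDeriv_specialFst (g : M → ℝ) :
    dirDeriv (specialFst φ) g x = -dirDeriv (chartField φ 0) g x := by
  simp [dirDeriv, specialFst]

theorem dirDeriv_specialSnd (g : M → ℝ) :
    dirDeriv (specialSnd φ f) g x = -f (φ x 0) ^ (3 / 4 : ℝ) * dirDeriv (chartField φ 1) g x := by
  simp [dirDeriv, specialSnd]

variable [RiemannianBundle (fun x : M ↦ TangentSpace (𝓡 2) x)]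
  {o : SurfaceOrientation M} {c : ℝ}

theorem IsSpecialChart.positive_frame (h : IsSpecialChart o c φ f) (hx : x ∈ φ.source) :
    IsPositiveBasis (o.toFun x) ![specialFst φ x, specialSnd φ f x] := by
  have hq := φ.map_source hx
  have h1 := h.positive.positive _ hq
  have h2 : coordVec φ (φ x) =
      ![chartField φ 0 (φ.symm (φ x)), chartField φ 1 (φ.symm (φ x))] := by
    ext i
    rw [coordVec_eq_chartField h.positive.mem_maximalAtlas hq]
    fin_cases i <;> rfl
  rw [h2, φ.left_inv hx] at h1
  exact h1.smul_smul (by have := Real.rpow_pos_of_pos (h.pos' hx) (3 / 4); linarith)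

variable [IsManifold (𝓡 2) ∞ M]

namespace IsSpecialChart

variable (h : IsSpecialChart o c φ f)
include h

theorem isFrameOn : IsFrameOn (specialFst φ) (specialSnd φ f) φ.source where
  isOpen := φ.open_source
  smooth₁ x hx := by
    have h1 : SmoothFunAt (fun _ : M ↦ (-1 : ℝ)) x := contMDiffAt_const
    exact h1.smul_section (smoothFieldAt_chartField h.positive.mem_maximalAtlas hx 0)
  smooth₂ x hx := by
    have h1 : SmoothFunAt (fun y ↦ -f (φ y 0) ^ (3 / 4 : ℝ)) x :=
      smoothFunAt_fst (g := fun t ↦ -f t ^ (3 / 4 : ℝ)) h.positive.mem_maximalAtlas hx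
        ((h.contDiffAt hx).rpow_const_of_ne (h.pos' hx).ne').neg
    exact h1.smul_section (smoothFieldAt_chartField h.positive.mem_maximalAtlas hx 1)
  inner₁₁ x hx := by
    simp only [specialFst, real_inner_smul_left, real_inner_smul_right, (h.inner_chartField hx).1]
    norm_num
  inner₁₂ x hx := by
    simp only [specialFst, specialSnd, real_inner_smul_left, real_inner_smul_right,
      (h.inner_chartField hx).2.1]
    norm_num
  inner₂₂ x hx := by
    have h0 := h.pos' hx
    have h1 : f (φ x 0) ^ (3 / 4 : ℝ) * f (φ x 0) ^ (3 / 4 : ℝ) = f (φ x 0) ^ (3 / 2 : ℝ) := by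
      rw [← Real.rpow_add h0]
      norm_num
    have h2 := (Real.rpow_pos_of_pos h0 (3 / 2)).ne'
    simp only [specialSnd, real_inner_smul_left, real_inner_smul_right,
      (h.inner_chartField hx).2.2]
    rw [← mul_assoc, neg_mul_neg, h1, mul_one_div_cancel h2]

theorem mlieBracket_frame (hx : x ∈ φ.source) :
    VectorField.mlieBracket (𝓡 2) (specialFst φ) (specialSnd φ f) x =
      -(3 / 4 * (deriv f (φ x 0) / f (φ x 0))) • specialSnd φ f x := by
  have hφ := h.positive.mem_maximalAtlas
  have h0 := h.pos' hx
  have hX := (smoothFieldAt_chartField hφ hx 0).diffFieldAt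
  have hY := (smoothFieldAt_chartField hφ hx 1).diffFieldAt
  have hg : HasDerivAt (fun t ↦ -f t ^ (3 / 4 : ℝ))
      (-(deriv f (φ x 0) * (3 / 4) * f (φ x 0) ^ ((3 / 4 : ℝ) - 1))) (φ x 0) :=
    ((h.hasDerivAt hx).rpow_const (Or.inl h0.ne')).neg
  have hgs : DiffFunAt (fun y ↦ -f (φ y 0) ^ (3 / 4 : ℝ)) x :=
    ContMDiffAt.diffFunAt (smoothFunAt_fst (g := fun t ↦ -f t ^ (3 / 4 : ℝ)) hφ hx
        ((h.contDiffAt hx).rpow_const_of_ne (h.pos' hx).ne').neg)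
  have h1 : VectorField.mlieBracket (𝓡 2) (specialFst φ) (chartField φ 1) x = 0 := by
    have := VectorField.mlieBracket_const_smul_left (I := 𝓡 2) (c := (-1 : ℝ))
      (W := chartField φ 1) hX
    refine this.trans ?_
    rw [mlieBracket_chartField hφ hx, smul_zero]
  refine (mlieBracket_smul_right_apply hgs hY).trans ?_
  rw [h1, smul_zero, add_zero, dirDeriv_specialFst,
    dirDeriv_chartField_zero_fst (g := fun t ↦ -f t ^ (3 / 4 : ℝ)) hφ hx hg, specialSnd, smul_smul,
    Real.rpow_sub_one h0.ne']
  congr 1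
  field_simp

variable [IsContMDiffRiemannianBundle (𝓡 2) ∞ Plane (fun x : M ↦ TangentSpace (𝓡 2) x)]

theorem connFst_eq (hx : x ∈ φ.source) : connFst (specialFst φ) (specialSnd φ f) x = 0 := by
  have hF := h.isFrameOn
  have h1 := (hF.mlieBracket_eq hx).symm.trans (h.mlieBracket_frame hx)
  have h2 := congrArg (fun v ↦ inner ℝ v (specialFst φ x)) h1
  simp only [inner_sub_left, real_inner_smul_left, hF.inner₁₁ x hx,
    real_inner_comm (specialFst φ x) (specialSnd φ f x), hF.inner₁₂ x hx] at h2
  linarith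

theorem connSnd_eq (hx : x ∈ φ.source) :
    connSnd (specialFst φ) (specialSnd φ f) x = 3 / 4 * (deriv f (φ x 0) / f (φ x 0)) := by
  have hF := h.isFrameOn
  have h1 := (hF.mlieBracket_eq hx).symm.trans (h.mlieBracket_frame hx)
  have h2 := congrArg (fun v ↦ inner ℝ v (specialSnd φ f x)) h1
  simp only [inner_sub_left, real_inner_smul_left, hF.inner₂₂ x hx, hF.inner₁₂ x hx] at h2
  linarith

/-- The differential equation for `f` expresses the curvature of the metric `du² + f^(-3/2) dv²`
in terms of `f`. -/
theorem gaussCurvature_eq (hx : x ∈ φ.source) :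
    gaussCurvature M x = -1 - 3 * f (φ x 0) ^ 2 - c ^ 2 * f (φ x 0) ^ 3 := by
  have hF := h.isFrameOn
  have h0 := h.pos' hx
  have ha : connFst (specialFst φ) (specialSnd φ f) =ᶠ[𝓝 x] fun _ ↦ 0 := by
    filter_upwards [φ.open_source.mem_nhds hx] with y hy using h.connFst_eq hy
  have hb : connSnd (specialFst φ) (specialSnd φ f) =ᶠ[𝓝 x]
      fun y ↦ 3 / 4 * (deriv f (φ y 0) / f (φ y 0)) := by
    filter_upwards [φ.open_source.mem_nhds hx] with y hy using h.connSnd_eq hy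
  have hd : HasDerivAt (fun t ↦ 3 / 4 * (deriv f t / f t))
      (3 / 4 * ((deriv (deriv f) (φ x 0) * f (φ x 0) - deriv f (φ x 0) * deriv f (φ x 0)) /
        f (φ x 0) ^ 2)) (φ x 0) :=
    (((h.contDiffAt_deriv hx).differentiableAt (by simp)).hasDerivAt.div (h.hasDerivAt hx)
      h0.ne').const_mul _
  have hode := h.ode _ ⟨_, φ.map_source hx, rfl⟩
  rw [hF.gaussCurvature_eq hx, dirDeriv_congr ha, dirDeriv_const, dirDeriv_congr hb,
    dirDeriv_specialFst, dirDeriv_chartField_zero_fst (g := fun t ↦ 3 / 4 * (deriv f t / f t))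
      h.positive.mem_maximalAtlas hx hd, h.connFst_eq hx, h.connSnd_eq hx]
  simp only at hode
  field_simp
  linear_combination 12 * hode

theorem gradient_gaussCurvature_eq (hx : x ∈ φ.source) :
    ∃ t : ℝ, 0 < t ∧ gradient (𝓡 2) (gaussCurvature M) x = t • specialFst φ x := by
  have hF := h.isFrameOn
  have hφ := h.positive.mem_maximalAtlas
  have h0 := h.pos' hx
  have hK : gaussCurvature M =ᶠ[𝓝 x]
      fun y ↦ -1 - 3 * f (φ y 0) ^ 2 - c ^ 2 * f (φ y 0) ^ 3 := by
    filter_upwards [φ.open_source.mem_nhds hx] with y hy using h.gaussCurvature_eq hy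
  have hd := ((((h.hasDerivAt hx).pow 2).const_mul 3).const_sub (-1)).sub
    (((h.hasDerivAt hx).pow 3).const_mul (c ^ 2))
  have hd' : HasDerivAt (fun t ↦ -1 - 3 * f t ^ 2 - c ^ 2 * f t ^ 3)
      (-((6 * f (φ x 0) + 3 * c ^ 2 * f (φ x 0) ^ 2) * deriv f (φ x 0))) (φ x 0) := by
    refine hd.congr_deriv ?_
    push_cast
    ring
  have hf' : 0 < deriv f (φ x 0) := h.deriv_pos _ ⟨_, φ.map_source hx, rfl⟩
  refine ⟨(6 * f (φ x 0) + 3 * c ^ 2 * f (φ x 0) ^ 2) * deriv f (φ x 0), by positivity, ?_⟩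
  rw [hF.gradient_eq hx, dirDeriv_congr hK, dirDeriv_congr hK, dirDeriv_specialFst,
    dirDeriv_specialSnd, dirDeriv_chartField_zero_fst
      (g := fun t ↦ -1 - 3 * f t ^ 2 - c ^ 2 * f t ^ 3) hφ hx hd',
    dirDeriv_chartField_one_fst (g := fun t ↦ -1 - 3 * f t ^ 2 - c ^ 2 * f t ^ 3) hφ hx hd',
    mul_zero, zero_smul, add_zero, neg_neg]

theorem unitField_gradient_eq (hx : x ∈ φ.source) :
    unitField (gradient (𝓡 2) (gaussCurvature M)) x = specialFst φ x := by
  obtain ⟨t, ht, h1⟩ := h.gradient_gaussCurvature_eq hx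
  have h2 : ‖specialFst φ x‖ = 1 := by
    have := h.isFrameOn.inner₁₁ x hx
    rw [real_inner_self_eq_norm_sq] at this
    nlinarith [norm_nonneg (specialFst φ x)]
  rw [unitField, h1, norm_smul, h2, mul_one, Real.norm_of_nonneg ht.le, smul_smul,
    inv_mul_cancel₀ ht.ne', one_smul]

end IsSpecialChart
end SpecialFrame

/-! ### From special charts to the form of the connection -/

section SpecialAt

/-- `t ↦ 3 t² + C t³` is injective on the positive reals if `C ≥ 0`. -/
theorem eq_of_quadratic_add_cubic_eq {C s t : ℝ} (hC : 0 ≤ C) (hs : 0 < s) (ht : 0 < t)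
    (h : 3 * s ^ 2 + C * s ^ 3 = 3 * t ^ 2 + C * t ^ 3) : s = t := by
  have h1 : (s - t) * (3 * (s + t) + C * (s ^ 2 + s * t + t ^ 2)) = 0 := by
    linear_combination h
  rcases mul_eq_zero.1 h1 with h2 | h2
  · linarith
  · have : 0 < 3 * (s + t) + C * (s ^ 2 + s * t + t ^ 2) := by positivity
    exact absurd h2 this.ne'

/-- The value of `3 s² + C s³` and that of `s d/ds (3 s² + C s³)` determine `s > 0` and `C`. -/
theorem eq_of_root_eq_of_deriv_eq {C D s t : ℝ} (hs : 0 < s) (ht : 0 < t)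
    (h : 3 * s ^ 2 + C * s ^ 3 = 3 * t ^ 2 + D * t ^ 3)
    (h' : 6 * s ^ 2 + 3 * C * s ^ 3 = 6 * t ^ 2 + 3 * D * t ^ 3) : C = D := by
  have h1 : s ^ 2 = t ^ 2 := by linarith
  have h2 : s = t := by
    rcases sq_eq_sq_iff_eq_or_eq_neg.1 h1 with h3 | h3 <;> linarith
  subst h2
  have h3 : s ^ 3 ≠ 0 := by positivity
  exact mul_right_cancel₀ h3 (by linarith)

variable {M : Type*} [TopologicalSpace M] [ChartedSpace Plane M] [IsManifold (𝓡 2) ∞ M]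
  [RiemannianBundle (fun x : M ↦ TangentSpace (𝓡 2) x)]
  [IsContMDiffRiemannianBundle (𝓡 2) ∞ Plane (fun x : M ↦ TangentSpace (𝓡 2) x)]

variable (M) in
/-- The unit vector field `grad K / |grad K|`. -/
def unitGrad : Π x : M, TangentSpace (𝓡 2) x := unitField (gradient (𝓡 2) (gaussCurvature M))

/-- The connection has the prescribed form at the point `x` in the frame consisting of
`grad K / |grad K|` and `E₂`, where the positive root of `1 + K + 3 f² + c² f³ = 0` is only
considered near `x`. -/
def IsSpecialAt (c : ℝ) (E₂ : Π x : M, TangentSpace (𝓡 2) x) (x : M) : Prop :=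
  1 + gaussCurvature M x < 0 ∧ gradient (𝓡 2) (gaussCurvature M) x ≠ 0 ∧
  ∃ f : M → ℝ,
    (∀ᶠ y in 𝓝 x, 0 < f y ∧ 1 + gaussCurvature M y + 3 * f y ^ 2 + c ^ 2 * f y ^ 3 = 0) ∧
    DiffFunAt f x ∧
    leviCivita (𝓡 2) M (unitGrad M) x (unitGrad M x) = 0 ∧
    leviCivita (𝓡 2) M E₂ x (unitGrad M x) = 0 ∧
    leviCivita (𝓡 2) M (unitGrad M) x (E₂ x) =
      -(3 / 4 * (dirDeriv (unitGrad M) f x / f x)) • E₂ x ∧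
    leviCivita (𝓡 2) M E₂ x (E₂ x) =
      (3 / 4 * (dirDeriv (unitGrad M) f x / f x)) • unitGrad M x

variable {o : SurfaceOrientation M} {c d : ℝ} {φ : OpenPartialHomeomorph M Plane} {f : ℝ → ℝ}
  {E₂ E₂' : Π x : M, TangentSpace (𝓡 2) x} {x : M}

/-- Only the square of the constant matters. -/
theorem IsSpecialAt.of_sq_eq (h : IsSpecialAt c E₂ x) (hcd : c ^ 2 = d ^ 2) :
    IsSpecialAt d E₂ x := by
  rw [IsSpecialAt] at h ⊢
  rwa [← hcd]

theorem IsSpecialAt.congr (h : IsSpecialAt c E₂ x) (h₂ : SmoothFieldAt E₂ x)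
    (he : E₂' =ᶠ[𝓝 x] E₂) : IsSpecialAt c E₂' x := by
  have h₂' : SmoothFieldAt E₂' x := by
    refine h₂.congr_of_eventuallyEq ?_
    filter_upwards [he] with y hy
    rw [hy]
  have h1 := leviCivita_congr h₂'.diffFieldAt h₂.diffFieldAt he
  rw [IsSpecialAt] at h ⊢
  rwa [h1, he.self_of_nhds]

theorem dirDeriv_unitGrad_gaussCurvature (h : gradient (𝓡 2) (gaussCurvature M) x ≠ 0) :
    0 < dirDeriv (unitGrad M) (gaussCurvature M) x := by
  rw [dirDeriv, ← inner_gradient, unitGrad, unitField, real_inner_smul_right,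
    real_inner_self_eq_norm_sq]
  have := norm_pos_iff.2 h
  positivity

theorem dirDeriv_gaussCurvature_of_root {V : Π x : M, TangentSpace (𝓡 2) x} {f : M → ℝ}
    (h : ∀ᶠ y in 𝓝 x, 0 < f y ∧ 1 + gaussCurvature M y + 3 * f y ^ 2 + c ^ 2 * f y ^ 3 = 0)
    (hf : DiffFunAt f x) :
    dirDeriv V (gaussCurvature M) x = -(6 * f x + 3 * c ^ 2 * f x ^ 2) * dirDeriv V f x := by
  have h1 : gaussCurvature M =ᶠ[𝓝 x] fun y ↦ -1 - 3 * f y ^ 2 - c ^ 2 * f y ^ 3 := by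
    filter_upwards [h] with y hy
    linarith [hy.2]
  have h2 : HasDerivAt (fun t : ℝ ↦ -1 - 3 * t ^ 2 - c ^ 2 * t ^ 3)
      (-(6 * f x + 3 * c ^ 2 * f x ^ 2)) (f x) := by
    refine ((((hasDerivAt_pow 2 (f x)).const_mul 3).const_sub (-1)).sub
      ((hasDerivAt_pow 3 (f x)).const_mul (c ^ 2))).congr_deriv ?_
    push_cast
    ring
  rw [dirDeriv_congr h1, dirDeriv_comp_real h2 hf]

/-- The constant `c²` is determined by the geometry at a single point: both `3 f² + c² f³` and its
derivative along `grad K`, divided by the logarithmic derivative of `f`, are. -/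
theorem IsSpecialAt.sq_eq_sq (hc : IsSpecialAt c E₂ x) (hd : IsSpecialAt d E₂ x)
    (h₂ : E₂ x ≠ 0) : c ^ 2 = d ^ 2 := by
  obtain ⟨-, hg, f, hf, hfd, -, -, hf₂, -⟩ := hc
  obtain ⟨-, -, g, hg', hgd, -, -, hg₂, -⟩ := hd
  have hK := dirDeriv_unitGrad_gaussCurvature hg
  have hKf := dirDeriv_gaussCurvature_of_root (V := unitGrad M) hf hfd
  have hKg := dirDeriv_gaussCurvature_of_root (V := unitGrad M) hg' hgd
  have hr := smul_left_injective ℝ h₂ (hf₂.symm.trans hg₂)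
  obtain ⟨hf0, hf1⟩ := hf.self_of_nhds
  obtain ⟨hg0, hg1⟩ := hg'.self_of_nhds
  -- the covariant derivative `∇_{E₂} E₁` determines the logarithmic derivative of the root
  set r := dirDeriv (unitGrad M) f x / f x with hrdef
  have hr' : dirDeriv (unitGrad M) g x / g x = r := by linarith
  have e1 : dirDeriv (unitGrad M) f x = r * f x := by rw [hrdef, div_mul_cancel₀ _ hf0.ne']
  have e2 : dirDeriv (unitGrad M) g x = r * g x := by rw [← hr', div_mul_cancel₀ _ hg0.ne']
  rw [e1] at hKf
  rw [e2] at hKg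
  have hr0 : r ≠ 0 := by
    intro h0
    rw [hKf, h0] at hK
    simp at hK
  refine eq_of_root_eq_of_deriv_eq hf0 hg0 (by linarith) ?_
  refine mul_left_cancel₀ hr0 ?_
  linarith

theorem IsSpecialChart.isSpecialAt (h : IsSpecialChart o c φ f) (hx : x ∈ φ.source) :
    IsSpecialAt c (specialSnd φ f) x := by
  have hF := h.isFrameOn
  have hφ := h.positive.mem_maximalAtlas
  have h0 := h.pos' hx
  have hU : unitGrad M =ᶠ[𝓝 x] specialFst φ := by
    filter_upwards [φ.open_source.mem_nhds hx] with y hy using h.unitField_gradient_eq hy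
  have hUs : SmoothFieldAt (unitGrad M) x := by
    refine (hF.smooth₁ x hx).congr_of_eventuallyEq ?_
    filter_upwards [hU] with y hy
    rw [hy]
  have hd : dirDeriv (unitGrad M) (fun y ↦ f (φ y 0)) x = -deriv f (φ x 0) := by
    have := dirDeriv_specialFst (φ := φ) (x := x) fun y ↦ f (φ y 0)
    rw [dirDeriv_chartField_zero_fst hφ hx (h.hasDerivAt hx)] at this
    rw [← this, dirDeriv, dirDeriv, hU.self_of_nhds]
  refine ⟨?_, ?_, fun y ↦ f (φ y 0), ?_, ContMDiffAt.diffFunAt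
    (smoothFunAt_fst hφ hx (h.contDiffAt hx)), ?_⟩
  · rw [h.gaussCurvature_eq hx]
    have : 0 < 3 * f (φ x 0) ^ 2 + c ^ 2 * f (φ x 0) ^ 3 := by positivity
    linarith
  · obtain ⟨t, ht, h1⟩ := h.gradient_gaussCurvature_eq hx
    rw [h1]
    refine smul_ne_zero ht.ne' fun h2 ↦ ?_
    have := hF.inner₁₁ x hx
    rw [h2, inner_zero_left] at this
    exact zero_ne_one this
  · filter_upwards [φ.open_source.mem_nhds hx] with y hy
    refine ⟨h.pos' hy, ?_⟩
    rw [h.gaussCurvature_eq hy]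
    ring
  · rw [leviCivita_congr hUs.diffFieldAt (hF.smooth₁ x hx).diffFieldAt hU, hd,
      hU.self_of_nhds, hF.leviCivita_fst hx, hF.leviCivita_snd hx, hF.leviCivita_fst hx,
      hF.leviCivita_snd hx]
    have h1 : connForm (specialFst φ) (specialSnd φ f) x (specialFst φ x) = 0 := h.connFst_eq hx
    have h2 : connForm (specialFst φ) (specialSnd φ f) x (specialSnd φ f x) =
      3 / 4 * (deriv f (φ x 0) / f (φ x 0)) := h.connSnd_eq hx
    rw [h1, h2]
    refine ⟨zero_smul _ _, by rw [neg_zero, zero_smul], ?_, ?_⟩ <;> congr 1 <;> ring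

/-- Special charts around all points of `M` yield a global frame: two of the local frames agree
where both are defined, as their first vector is `grad K / |grad K|`. -/
theorem exists_frame_of_forall_isSpecialChart
    (h : ∀ p : M, ∃ c : ℝ, c ≠ 0 ∧ ∃ (φ : OpenPartialHomeomorph M Plane) (f : ℝ → ℝ),
      p ∈ φ.source ∧ IsSpecialChart o c φ f) :
    ∃ E₂ : Π x : M, TangentSpace (𝓡 2) x, IsCurvatureFrame o (unitGrad M) E₂ ∧
      ∀ (c : ℝ) (φ : OpenPartialHomeomorph M Plane) (f : ℝ → ℝ), IsSpecialChart o c φ f →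
        ∀ x ∈ φ.source, IsSpecialAt c E₂ x := by
  choose c _ φ f hp hs using h
  have key : ∀ {c : ℝ} {φ : OpenPartialHomeomorph M Plane} {f : ℝ → ℝ} {x : M},
      IsSpecialChart o c φ f → x ∈ φ.source →
      Orthonormal ℝ ![unitGrad M x, specialSnd φ f x] ∧
        IsPositiveBasis (o.toFun x) ![unitGrad M x, specialSnd φ f x] := by
    intro c φ f x h hx
    have hF := h.isFrameOn
    have h1 : unitGrad M x = specialFst φ x := h.unitField_gradient_eq hx
    rw [h1]
    exact ⟨orthonormal_pair_iff.2 ⟨hF.inner₁₁ x hx, hF.inner₁₂ x hx, hF.inner₂₂ x hx⟩,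
      h.positive_frame hx⟩
  refine ⟨fun x ↦ specialSnd (φ x) (f x) x, ⟨fun x ↦ rfl, fun x ↦ (key (hs x) (hp x)).1,
    fun x ↦ (key (hs x) (hp x)).2⟩, fun c' φ' f' h' x hx ↦ ?_⟩
  refine (h'.isSpecialAt hx).congr (h'.isFrameOn.smooth₂ x hx) ?_
  filter_upwards [φ'.open_source.mem_nhds hx] with y hy
  exact eq_of_positive_orthonormal (V := TangentSpace (𝓡 2) y)
    (finrank_euclideanSpace_fin (𝕜 := ℝ) (n := 2)) (key (hs y) (hp y)).1 (key h' hy).1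
    (key (hs y) (hp y)).2 (key h' hy).2

/-- The local data of `IsSpecialAt` fit together, since the root of `1 + K + 3 f² + c² f³ = 0` is
unique. -/
theorem hasSpecialConnection_of_forall_isSpecialAt (hE : IsCurvatureFrame o (unitGrad M) E₂)
    (h : ∀ x, IsSpecialAt c E₂ x) : HasSpecialConnection o c := by
  choose h1 h2 f hf hfd hL using h
  refine ⟨h1, h2, fun x ↦ f x x, fun x ↦ (hf x).self_of_nhds, unitGrad M, E₂, hE, fun x ↦ ?_⟩
  have h3 : (fun x ↦ f x x) =ᶠ[𝓝 x] f x := by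
    filter_upwards [hf x] with y hy
    obtain ⟨h4, h5⟩ := (hf y).self_of_nhds
    exact eq_of_quadratic_add_cubic_eq (sq_nonneg c) h4 hy.1 (by linarith [hy.2])
  have h4 := dirDeriv_congr (V := unitGrad M) h3
  change _ ∧ _ ∧ _ = -(3 / 4 * (dirDeriv (unitGrad M) (fun x ↦ f x x) x / f x x)) • E₂ x ∧
    _ = (3 / 4 * (dirDeriv (unitGrad M) (fun x ↦ f x x) x / f x x)) • unitGrad M x
  rw [h4]
  exact hL x

theorem hasSpecialConnection_of_forall_isSpecialChart (hc : c ≠ 0)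
    (h : ∀ p : M, ∃ (φ : OpenPartialHomeomorph M Plane) (f : ℝ → ℝ),
      p ∈ φ.source ∧ IsSpecialChart o c φ f) : HasSpecialConnection o c := by
  obtain ⟨E₂, hE, h1⟩ := exists_frame_of_forall_isSpecialChart fun p ↦ ⟨c, hc, h p⟩
  refine hasSpecialConnection_of_forall_isSpecialAt hE fun x ↦ ?_
  obtain ⟨φ, f, hx, hs⟩ := h x
  exact h1 c φ f hs x hx

/-- On a connected surface the constant of a special chart cannot depend on the chart, because `c²`
is locally constant. -/
theorem exists_hasSpecialConnection [ConnectedSpace M]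
    (h : ∀ p : M, ∃ c : ℝ, c ≠ 0 ∧ ∃ (φ : OpenPartialHomeomorph M Plane) (f : ℝ → ℝ),
      p ∈ φ.source ∧ IsSpecialChart o c φ f) :
    ∃ c : ℝ, c ≠ 0 ∧ HasSpecialConnection o c := by
  obtain ⟨E₂, hE, h1⟩ := exists_frame_of_forall_isSpecialChart h
  choose c hc φ f hp hs using h
  have h0 : ∀ x, E₂ x ≠ 0 := fun x ↦ (hE.orthonormal x).ne_zero 1
  have h2 : IsLocallyConstant fun x ↦ c x ^ 2 := by
    refine (IsLocallyConstant.iff_eventually_eq _).2 fun x ↦ ?_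
    filter_upwards [(φ x).open_source.mem_nhds (hp x)] with y hy
    exact (h1 _ _ _ (hs y) y (hp y)).sq_eq_sq (h1 _ _ _ (hs x) y hy) (h0 y)
  obtain ⟨p⟩ := (inferInstance : Nonempty M)
  refine ⟨c p, hc p, hasSpecialConnection_of_forall_isSpecialAt hE fun x ↦ ?_⟩
  exact (h1 _ _ _ (hs x) x (hp x)).of_sq_eq (h2.apply_eq_of_isPreconnected isPreconnected_univ
    (mem_univ _) (mem_univ _))

end SpecialAt

/-! ### Rectification of commuting vector fields in the plane -/

section Rectification

/-- The linear endomorphism of the plane that maps the standard basis to `v, w`. -/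
def frameMap (v w : Plane) : Plane →L[ℝ] Plane :=
  (EuclideanSpace.proj (𝕜 := ℝ) (0 : Fin 2)).smulRight v +
    (EuclideanSpace.proj (𝕜 := ℝ) (1 : Fin 2)).smulRight w

theorem frameMap_apply (v w p : Plane) : frameMap v w p = p 0 • v + p 1 • w := rfl

theorem frameMap_single_zero (v w : Plane) : frameMap v w (EuclideanSpace.single 0 1) = v := by
  simp [frameMap_apply]

theorem frameMap_single_one (v w : Plane) : frameMap v w (EuclideanSpace.single 1 1) = w := by
  simp [frameMap_apply]

theorem isInvertible_frameMap {v w : Plane} (h : LinearIndependent ℝ ![v, w]) :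
    (frameMap v w).IsInvertible := by
  have hinj : Function.Injective (frameMap v w : Plane →ₗ[ℝ] Plane) := by
    rw [← LinearMap.ker_eq_bot, LinearMap.ker_eq_bot']
    intro p hp
    have := LinearIndependent.pair_iff.1 h (p 0) (p 1) hp
    ext i
    fin_cases i
    exacts [this.1, this.2]
  exact ⟨(LinearEquiv.ofInjectiveEndo _ hinj).toContinuousLinearEquiv, by ext; rfl⟩

theorem contDiffAt_frameMap {X Y : Plane → Plane} {q : Plane} (hX : ContDiffAt ℝ ∞ X q)
    (hY : ContDiffAt ℝ ∞ Y q) : ContDiffAt ℝ ∞ (fun q ↦ frameMap (X q) (Y q)) q :=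
  (contDiffAt_const.smulRight hX).add (contDiffAt_const.smulRight hY)

/-- The coframe `ω` dual to commuting vector fields `X, Y` is closed: this is the identity
`dω(X, Y) = X (ω Y) - Y (ω X) - ω [X, Y]`. -/
theorem fderiv_inverse_frameMap_symm {X Y : Plane → Plane} {q : Plane} (hX : ContDiffAt ℝ ∞ X q)
    (hY : ContDiffAt ℝ ∞ Y q) (hi : ∀ᶠ p in 𝓝 q, (frameMap (X p) (Y p)).IsInvertible)
    (hXY : fderiv ℝ Y q (X q) = fderiv ℝ X q (Y q)) (v w : Plane) :
    fderiv ℝ (fun p ↦ (frameMap (X p) (Y p)).inverse) q v w =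
      fderiv ℝ (fun p ↦ (frameMap (X p) (Y p)).inverse) q w v := by
  set θ : Plane → Plane →L[ℝ] Plane := fun p ↦ (frameMap (X p) (Y p)).inverse with hθ
  have hiq := hi.self_of_nhds
  have hθs : ContDiffAt ℝ ∞ θ q :=
    ContDiffAt.comp (g := ContinuousLinearMap.inverse) q hiq.contDiffAt_map_inverse
      (contDiffAt_frameMap hX hY)
  have hθd : DifferentiableAt ℝ θ q := hθs.differentiableAt (by simp)
  have hXd := hX.differentiableAt (by simp)
  have hYd := hY.differentiableAt (by simp)
  have h1 : (fun p ↦ θ p (X p)) =ᶠ[𝓝 q] fun _ ↦ EuclideanSpace.single 0 1 := by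
    filter_upwards [hi] with p hp
    have := hp.inverse_apply_self (EuclideanSpace.single 0 1)
    rwa [frameMap_single_zero] at this
  have h2 : (fun p ↦ θ p (Y p)) =ᶠ[𝓝 q] fun _ ↦ EuclideanSpace.single 1 1 := by
    filter_upwards [hi] with p hp
    have := hp.inverse_apply_self (EuclideanSpace.single 1 1)
    rwa [frameMap_single_one] at this
  have h3 := h1.fderiv_eq (𝕜 := ℝ)
  have h4 := h2.fderiv_eq (𝕜 := ℝ)
  rw [fderiv_clm_apply hθd hXd, fderiv_const_apply] at h3
  rw [fderiv_clm_apply hθd hYd, fderiv_const_apply] at h4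
  have h5 := DFunLike.congr_fun h3 (Y q)
  have h6 := DFunLike.congr_fun h4 (X q)
  simp only [add_apply, ContinuousLinearMap.comp_apply, ContinuousLinearMap.flip_apply,
    zero_apply] at h5 h6
  rw [hXY] at h6
  have h7 : fderiv ℝ θ q (X q) (Y q) = fderiv ℝ θ q (Y q) (X q) :=
    add_left_cancel (h6.trans h5.symm)
  obtain ⟨a, rfl⟩ := hiq.surjective v
  obtain ⟨b, rfl⟩ := hiq.surjective w
  simp only [frameMap_apply, map_add, map_smul, add_apply, smul_apply, h7]
  module

/-- Commuting, linearly independent vector fields in the plane are the coordinate vector fields of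
a local diffeomorphism: the dual coframe is closed, hence exact, and a primitive of it is the
diffeomorphism. -/
theorem exists_rectification {X Y : Plane → Plane} {q₀ : Plane} {U : Set Plane} (hU : IsOpen U)
    (hq₀ : q₀ ∈ U) (hX : ∀ q ∈ U, ContDiffAt ℝ ∞ X q) (hY : ∀ q ∈ U, ContDiffAt ℝ ∞ Y q)
    (hli : LinearIndependent ℝ ![X q₀, Y q₀])
    (hXY : ∀ q ∈ U, fderiv ℝ Y q (X q) = fderiv ℝ X q (Y q)) :
    ∃ ψ : OpenPartialHomeomorph Plane Plane, q₀ ∈ ψ.source ∧ ψ.source ⊆ U ∧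
      (∃ r > 0, ψ.target = Metric.ball (ψ q₀) r) ∧ ContDiffOn ℝ ∞ ψ ψ.source ∧
      ContDiffOn ℝ ∞ ψ.symm ψ.target ∧
      ∀ q ∈ ψ.source, DifferentiableAt ℝ ψ q ∧ fderiv ℝ ψ q (X q) = EuclideanSpace.single 0 1 ∧
        fderiv ℝ ψ q (Y q) = EuclideanSpace.single 1 1 := by
  -- on a ball `B` around `q₀` the fields are independent, and `θ` is the coframe dual to them
  set A : Plane → Plane →L[ℝ] Plane := fun q ↦ frameMap (X q) (Y q) with hA
  have hAs : ∀ q ∈ U, ContDiffAt ℝ ∞ A q := fun q hq ↦ contDiffAt_frameMap (hX q hq) (hY q hq)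
  have hev : ∀ᶠ q in 𝓝 q₀, q ∈ U ∧ (A q).IsInvertible :=
    (hU.eventually_mem hq₀).and ((hAs q₀ hq₀).continuousAt.eventually
      (ContinuousLinearEquiv.isOpen.mem_nhds (isInvertible_frameMap hli)))
  obtain ⟨ε, hε, hB⟩ := Metric.eventually_nhds_iff_ball.1 hev
  set B := Metric.ball q₀ ε with hBdef
  have hBo : IsOpen B := Metric.isOpen_ball
  have hq₀B : q₀ ∈ B := Metric.mem_ball_self hε
  set θ : Plane → Plane →L[ℝ] Plane := fun q ↦ (A q).inverse with hθ
  have hθs : ContDiffOn ℝ ∞ θ B := fun q hq ↦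
    (ContDiffAt.comp (g := ContinuousLinearMap.inverse) q (hB q hq).2.contDiffAt_map_inverse
      (hAs q (hB q hq).1)).contDiffWithinAt
  -- a primitive `F` of the closed coframe, by the Poincaré lemma
  obtain ⟨F, hF⟩ : ∃ F, ∀ a ∈ B, HasFDerivAt F (θ a) a := by
    refine (convex_ball q₀ ε).exists_forall_hasFDerivAt_of_fderiv_symmetric hBo
      (hθs.differentiableOn (by simp)) fun a ha v w ↦ ?_
    refine fderiv_inverse_frameMap_symm (hX a (hB a ha).1) (hY a (hB a ha).1) ?_
      (hXY a (hB a ha).1) v w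
    filter_upwards [hBo.mem_nhds ha] with p hp using (hB p hp).2
  have hFs : ContDiffOn ℝ ∞ F B := by
    refine (contDiffOn_infty_iff_fderiv_of_isOpen hBo).2
      ⟨fun a ha ↦ (hF a ha).differentiableAt.differentiableWithinAt, ?_⟩
    exact hθs.congr fun a ha ↦ (hF a ha).fderiv
  have hθe : ∀ a ∈ B, ∃ e : Plane ≃L[ℝ] Plane, (e : Plane →L[ℝ] Plane) = θ a :=
    fun a ha ↦ (hB a ha).2.inverse
  obtain ⟨e, he⟩ := hθe q₀ hq₀B
  have hF₀ := hFs.contDiffAt (hBo.mem_nhds hq₀B)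
  have hF₀' : HasFDerivAt F (e : Plane →L[ℝ] Plane) q₀ := he ▸ hF q₀ hq₀B
  -- the local inverse of `F`, restricted first to `B`, then to the preimage of a disk
  set ψ₁ := (hF₀.toOpenPartialHomeomorph F hF₀' (by simp)).restrOpen B hBo with hψ₁
  have hq₁ : q₀ ∈ ψ₁.source := ⟨hF₀.mem_toOpenPartialHomeomorph_source hF₀' (by simp), hq₀B⟩
  have hψ₁F : ∀ q, ψ₁ q = F q := fun q ↦ rfl
  obtain ⟨r, hr, hrt⟩ := Metric.isOpen_iff.1 ψ₁.open_target _ (ψ₁.map_source hq₁)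
  set ψ := (ψ₁.symm.restrOpen (Metric.ball (ψ₁ q₀) r) Metric.isOpen_ball).symm with hψ
  have hψF : (ψ : Plane → Plane) = F := rfl
  have hsrc : ψ.source ⊆ B := by
    intro q hq
    have hq' : q ∈ ψ₁.source := by
      have h1 := ψ.map_source hq
      have h2 := ψ₁.map_target (show ψ q ∈ ψ₁.target from h1.1)
      have h3 : ψ₁.symm (ψ q) = q := ψ.left_inv hq
      rwa [h3] at h2
    exact hq'.2
  have htgt : ψ.target = Metric.ball (ψ q₀) r := by
    change ψ₁.target ∩ Metric.ball (ψ₁ q₀) r = Metric.ball (ψ₁ q₀) r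
    exact inter_eq_right.2 hrt
  have hq : q₀ ∈ ψ.source := by
    have h1 : ψ q₀ ∈ ψ.target := by
      rw [htgt]
      exact Metric.mem_ball_self hr
    have h2 := ψ.map_target h1
    have h3 : ψ.symm (ψ q₀) = q₀ := ψ₁.left_inv hq₁
    rwa [h3] at h2
  refine ⟨ψ, hq, fun q hq ↦ (hB q (hsrc hq)).1, ⟨r, hr, htgt⟩, hFs.mono hsrc, ?_, ?_⟩
  · intro a ha
    have hb := hsrc (ψ.map_target ha)
    obtain ⟨e', he'⟩ := hθe _ hb
    refine (ψ.contDiffAt_symm (f₀' := e') ha ?_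
      (hFs.contDiffAt (hBo.mem_nhds hb))).contDiffWithinAt
    rw [he']
    exact hF _ hb
  · intro q hq
    have hb := hsrc hq
    rw [hψF, (hF q hb).fderiv]
    have h1 := (hB q hb).2.inverse_apply_self (EuclideanSpace.single 0 1)
    have h2 := (hB q hb).2.inverse_apply_self (EuclideanSpace.single 1 1)
    simp only [hA, frameMap_single_zero, frameMap_single_one] at h1 h2
    exact ⟨(hF q hb).differentiableAt, h1, h2⟩

end Rectification

/-! ### Rectification of commuting vector fields on a surface -/

section CoordinateFields

variable {M : Type*} [TopologicalSpace M] [ChartedSpace Plane M]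
  {κ : OpenPartialHomeomorph M Plane} {x : M} {q : Plane} {X Y : Π x : M, TangentSpace (𝓡 2) x}

/-- The vector field `X` in the coordinates of a chart. -/
def readField (κ : OpenPartialHomeomorph M Plane) (X : Π x : M, TangentSpace (𝓡 2) x) :
    Plane → Plane :=
  fun q ↦ VectorField.mpullback (𝓡 2) (𝓡 2) κ.symm X q

variable (hκ : κ ∈ IsManifold.maximalAtlas (𝓡 2) ∞ M)
include hκ

theorem isInvertible_mfderiv_symm_of_mem_maximalAtlas (hq : q ∈ κ.target) :
    (mfderiv (𝓡 2) (𝓡 2) κ.symm q).IsInvertible :=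
  ⟨(mdifferentiable_of_mem_maximalAtlas hκ).symm.mfderiv hq, rfl⟩

/-- The derivative of the chart maps a vector field to its coordinate expression. -/
theorem mfderiv_eq_readField (hx : x ∈ κ.source) :
    mfderiv (𝓡 2) (𝓡 2) κ x (X x) = readField κ X (κ x) := by
  have key : ∀ q ∈ κ.target,
      mfderiv (𝓡 2) (𝓡 2) κ (κ.symm q) (X (κ.symm q)) = readField κ X q := by
    intro q hq
    have h1 : mfderiv (𝓡 2) (𝓡 2) κ.symm q (readField κ X q) = X (κ.symm q) :=
      (isInvertible_mfderiv_symm_of_mem_maximalAtlas hκ hq).self_apply_inverse _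
    rw [← h1]
    exact DFunLike.congr_fun ((mdifferentiable_of_mem_maximalAtlas hκ).comp_symm_deriv hq)
      (readField κ X q)
  have h2 := key (κ x) (κ.map_source hx)
  rwa [κ.left_inv hx] at h2

variable [IsManifold (𝓡 2) ∞ M]

theorem contDiffAt_readField (hq : q ∈ κ.target) (hX : SmoothFieldAt X (κ.symm q)) :
    ContDiffAt ℝ ∞ (readField κ X) q := by
  have h1 : SmoothFieldAt (M := Plane) (VectorField.mpullback (𝓡 2) (𝓡 2) κ.symm X) q :=
    ContMDiffAt.mpullback_vectorField_preimage (n := ∞) hX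
      (contMDiffAt_symm_of_mem_maximalAtlas hκ hq)
      (isInvertible_mfderiv_symm_of_mem_maximalAtlas hκ hq) (by simp)
  exact contMDiffAt_vectorSpace_iff_contDiffAt.1 h1

theorem fderiv_readField_comm (hq : q ∈ κ.target) (hX : DiffFieldAt X (κ.symm q))
    (hY : DiffFieldAt Y (κ.symm q)) (hXY : VectorField.mlieBracket (𝓡 2) X Y (κ.symm q) = 0) :
    fderiv ℝ (readField κ Y) q (readField κ X q) =
      fderiv ℝ (readField κ X) q (readField κ Y q) := by
  have : IsManifold (𝓡 2) (minSmoothness ℝ 2) M := by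
    simp only [minSmoothness_of_isRCLikeNormedField]
    infer_instance
  have h := VectorField.mpullback_mlieBracket (n := ∞) hX hY
    (contMDiffAt_symm_of_mem_maximalAtlas hκ hq)
    (by simp only [minSmoothness_of_isRCLikeNormedField]; exact ENat.LEInfty.out)
  have h1 : VectorField.mpullback (𝓡 2) (𝓡 2) κ.symm (VectorField.mlieBracket (𝓡 2) X Y) q = 0 := by
    rw [VectorField.mpullback_apply, hXY, map_zero]
  exact sub_eq_zero.1 ((mlieBracket_plane (readField κ X) (readField κ Y) q).symm.trans
    (h.symm.trans h1))

omit hκ in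
/-- Commuting, linearly independent vector fields are locally the coordinate vector fields of a
chart; its target can be chosen to be a disk. -/
theorem exists_chartField_eq (hX : ∀ x, SmoothFieldAt X x) (hY : ∀ x, SmoothFieldAt Y x)
    (hXY : ∀ x, VectorField.mlieBracket (𝓡 2) X Y x = 0)
    (hli : ∀ x, LinearIndependent ℝ ![X x, Y x]) (p : M) :
    ∃ φ ∈ IsManifold.maximalAtlas (𝓡 2) ∞ M, p ∈ φ.source ∧
      (∃ r > 0, φ.target = Metric.ball (φ p) r) ∧
      ∀ x ∈ φ.source, chartField φ 0 x = X x ∧ chartField φ 1 x = Y x := by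
  set κ := chartAt Plane p with hκdef
  have hκ : κ ∈ IsManifold.maximalAtlas (𝓡 2) ∞ M := IsManifold.chart_mem_maximalAtlas p
  have hp : p ∈ κ.source := mem_chart_source Plane p
  have hli' : LinearIndependent ℝ ![readField κ X (κ p), readField κ Y (κ p)] := by
    have hinj := (isInvertible_mfderiv_of_mem_maximalAtlas hκ hp).injective
    rw [LinearIndependent.pair_iff]
    intro s t hst
    rw [← mfderiv_eq_readField hκ hp, ← mfderiv_eq_readField hκ hp] at hst
    refine LinearIndependent.pair_iff.1 (hli p) s t (hinj ?_)
    rw [map_add, map_smul, map_smul, map_zero]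
    exact hst
  obtain ⟨ψ, hpψ, hsub, ⟨r, hr, hrt⟩, hψ, hψ', hψXY⟩ :=
    exists_rectification κ.open_target (κ.map_source hp)
      (fun q hq ↦ contDiffAt_readField hκ hq (hX _)) (fun q hq ↦ contDiffAt_readField hκ hq (hY _))
      hli' fun q hq ↦ fderiv_readField_comm hκ hq (hX _).diffFieldAt (hY _).diffFieldAt (hXY _)
  set φ := κ.trans ψ with hφdef
  have hsrc : ∀ x ∈ φ.source, x ∈ κ.source ∧ κ x ∈ ψ.source := fun x hx ↦ by
    simpa [hφdef] using hx
  have htgt : φ.target = ψ.target := by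
    ext q
    simp only [hφdef, OpenPartialHomeomorph.trans_target, mem_inter_iff, mem_preimage,
      and_iff_left_iff_imp]
    exact fun hq ↦ hsub (ψ.map_target hq)
  have hφ : φ ∈ IsManifold.maximalAtlas (𝓡 2) ∞ M := by
    refine φ.mem_maximalAtlas_of_contMDiffOn ?_ ?_
    · exact hψ.contMDiffOn.comp ((contMDiffOn_of_mem_maximalAtlas hκ).mono
        fun x hx ↦ (hsrc x hx).1) fun x hx ↦ (hsrc x hx).2
    · rw [htgt]
      exact (contMDiffOn_symm_of_mem_maximalAtlas hκ).comp hψ'.contMDiffOn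
        fun q hq ↦ hsub (ψ.map_target hq)
  refine ⟨φ, hφ, by simpa [hφdef] using ⟨hp, hpψ⟩, ⟨r, hr, htgt.trans hrt⟩, fun x hx ↦ ?_⟩
  obtain ⟨hxκ, hxψ⟩ := hsrc x hx
  obtain ⟨hd, h0, h1⟩ := hψXY _ hxψ
  have hcomp : ∀ Z : Π x : M, TangentSpace (𝓡 2) x, mfderiv (𝓡 2) (𝓡 2) φ x (Z x) =
      fderiv ℝ ψ (κ x) (readField κ Z (κ x)) := by
    intro Z
    rw [← mfderiv_eq_readField hκ hxκ]
    have h2 := mfderiv_comp (I := 𝓡 2) (I' := 𝓡 2) (I'' := 𝓡 2) x hd.mdifferentiableAt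
      ((mdifferentiable_of_mem_maximalAtlas hκ).mdifferentiableAt hxκ)
    rw [mfderiv_eq_fderiv] at h2
    exact DFunLike.congr_fun h2 (Z x)
  have hinj := (isInvertible_mfderiv_of_mem_maximalAtlas hφ hx).injective
  constructor
  · exact hinj ((mfderiv_chartField hφ hx 0).trans
      ((tangentBasis_eq_single (φ x) 0).trans (h0.symm.trans (hcomp X).symm)))
  · exact hinj ((mfderiv_chartField hφ hx 1).trans
      ((tangentBasis_eq_single (φ x) 1).trans (h1.symm.trans (hcomp Y).symm)))

end CoordinateFields

/-! ### Smoothness of the root and of the frame -/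

section SmoothRoot

variable {M : Type*} [TopologicalSpace M] [ChartedSpace Plane M] {x : M}

/-- The positive solution `f` of `3 f² + C f³ = k` is a smooth function of `k`, by the inverse
function theorem. -/
theorem smoothFunAt_of_quadratic_add_cubic_eq {C : ℝ} {f k : M → ℝ} (hC : 0 ≤ C)
    (hf : ∀ y, 0 < f y) (hk : SmoothFunAt k x) (h : ∀ y, 3 * f y ^ 2 + C * f y ^ 3 = k y) :
    SmoothFunAt f x := by
  set P : ℝ → ℝ := fun t ↦ 3 * t ^ 2 + C * t ^ 3 with hP
  have hPs : ContDiff ℝ ∞ P := by fun_prop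
  have hPd : ∀ t, HasDerivAt P (6 * t + 3 * C * t ^ 2) t := by
    intro t
    refine (((hasDerivAt_pow 2 t).const_mul 3).add
      ((hasDerivAt_pow 3 t).const_mul C)).congr_deriv ?_
    push_cast
    ring
  have hx := hf x
  have h0 : 6 * f x + 3 * C * f x ^ 2 ≠ 0 := by positivity
  have hPd' := (hPd (f x)).hasFDerivAt_equiv h0
  set e := hPs.contDiffAt.toOpenPartialHomeomorph P hPd' (by simp) with he
  have heP : ∀ t, e t = P t := fun t ↦ rfl
  have hes : f x ∈ e.source := hPs.contDiffAt.mem_toOpenPartialHomeomorph_source hPd' (by simp)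
  have hkx : k x = e (f x) := (h x).symm
  have het : k x ∈ e.target := hkx ▸ e.map_source hes
  have hex : e.symm (k x) = f x := by rw [hkx, e.left_inv hes]
  have hsymm : ContDiffAt ℝ ∞ e.symm (k x) :=
    e.contDiffAt_symm_deriv h0 het (hex ▸ hPd (f x)) (hex ▸ hPs.contDiffAt)
  refine (smoothFunAt_comp_real hsymm hk).congr_of_eventuallyEq ?_
  have hpos : ∀ᶠ s in 𝓝 (k x), 0 < e.symm s :=
    hsymm.continuousAt.eventually (lt_mem_nhds (hex ▸ hx))
  filter_upwards [hk.continuousAt.eventually (hpos.and (e.open_target.mem_nhds het))] with y hy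
  refine eq_of_quadratic_add_cubic_eq hC (hf y) hy.1 ((h y).trans ?_)
  exact (e.right_inv hy.2).symm

end SmoothRoot

section SmoothCompletion

variable {M : Type*} [TopologicalSpace M] [ChartedSpace Plane M] [IsManifold (𝓡 2) ∞ M]
  [RiemannianBundle (fun x : M ↦ TangentSpace (𝓡 2) x)]
  [IsContMDiffRiemannianBundle (𝓡 2) ∞ Plane (fun x : M ↦ TangentSpace (𝓡 2) x)]
  {E₁ E₂ : Π x : M, TangentSpace (𝓡 2) x} {x : M}

/-- By definition, the connection vanishes at a field which is not differentiable. -/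
theorem diffFieldAt_of_leviCivita_ne_zero {v : TangentSpace (𝓡 2) x}
    (h : leviCivita (𝓡 2) M E₂ x v ≠ 0) : DiffFieldAt E₂ x := by
  by_contra h1
  refine h ?_
  change leviCivitaFun E₂ x v = 0
  rw [leviCivitaFun, dif_neg h1]
  rfl

/-- A vector field that completes a smooth unit vector field to orthonormal frames is determined up
to sign, and differentiability forces the sign to be locally constant. -/
theorem smoothFieldAt_of_orthonormal (h₁ : ∀ y, SmoothFieldAt E₁ y) (h₂ : DiffFieldAt E₂ x)
    (ho : ∀ y, Orthonormal ℝ ![E₁ y, E₂ y]) : SmoothFieldAt E₂ x := by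
  obtain ⟨e₁, e₂, U, hx, hF⟩ := exists_isFrameOn x
  -- `J` is `E₁` rotated by a right angle, and `E₂ = s J` with `s = ±1`
  set J : Π y : M, TangentSpace (𝓡 2) y := fun y ↦
    (-(inner ℝ (E₁ y) (e₂ y) : ℝ)) • e₁ y + (inner ℝ (E₁ y) (e₁ y) : ℝ) • e₂ y with hJ
  have hJs : SmoothFieldAt J x :=
    ((smoothFunAt_neg (smoothFunAt_inner (h₁ x) (hF.smooth₂ x hx))).smul_section
      (hF.smooth₁ x hx)).add_section
      ((smoothFunAt_inner (h₁ x) (hF.smooth₁ x hx)).smul_section (hF.smooth₂ x hx))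
  set s : M → ℝ := fun y ↦ inner ℝ (E₂ y) (J y) with hs
  have hsc : ContinuousAt s x := (diffFunAt_inner h₂ hJs.diffFieldAt).continuousAt
  have key : ∀ y ∈ U, E₂ y = s y • J y ∧ s y * s y = 1 := by
    intro y hy
    obtain ⟨a11, a12, a22⟩ := orthonormal_pair_iff.1 (ho y)
    have b1 := hF.inner_eq hy (E₁ y) (E₁ y)
    have b2 := hF.inner_eq hy (E₁ y) (E₂ y)
    have b3 := hF.inner_eq hy (E₂ y) (E₂ y)
    rw [a11] at b1
    rw [a12] at b2
    rw [a22] at b3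
    set α : ℝ := inner ℝ (E₁ y) (e₁ y) with hα
    set β : ℝ := inner ℝ (E₁ y) (e₂ y) with hβ
    set γ : ℝ := inner ℝ (E₂ y) (e₁ y) with hγ
    set δ : ℝ := inner ℝ (E₂ y) (e₂ y) with hδ
    have hsy : s y = -β * γ + α * δ := by
      simp only [hs, hJ, inner_add_right, real_inner_smul_right]
      rfl
    have c1 : γ = s y * -β := by
      rw [hsy]
      linear_combination γ * b1 - α * b2
    have c2 : δ = s y * α := by
      rw [hsy]
      linear_combination δ * b1 - β * b2
    constructor
    · rw [hF.eq_inner_smul_add hy (E₂ y)]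
      change γ • e₁ y + δ • e₂ y = s y • (-β • e₁ y + α • e₂ y)
      rw [c1, c2, smul_add, smul_smul, smul_smul]
    · linear_combination (s y * s y) * b1 - b3 + (-γ + s y * β) * c1 + (-δ - s y * α) * c2
  have hev : ∀ᶠ y in 𝓝 x, 0 < s y * s x := by
    refine (hsc.mul continuousAt_const).eventually (lt_mem_nhds ?_)
    change 0 < s x * s x
    rw [(key x hx).2]
    exact one_pos
  have hJs' : SmoothFieldAt (fun y ↦ s x • J y) x :=
    (contMDiffAt_const (c := s x) : SmoothFunAt (fun _ : M ↦ s x) x).smul_section hJs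
  refine hJs'.congr_of_eventuallyEq ?_
  filter_upwards [hev, hF.isOpen.mem_nhds hx] with y hy hyU
  obtain ⟨k1, k2⟩ := key y hyU
  have : s y = s x := by
    rcases mul_self_eq_mul_self_iff.1 (k2.trans (key x hx).2.symm) with h3 | h3
    · exact h3
    · rw [h3] at hy
      nlinarith [mul_self_nonneg (s x)]
  rw [k1, this]

end SmoothCompletion

section SpecialFrame

variable {M : Type*} [TopologicalSpace M] [ChartedSpace Plane M] [IsManifold (𝓡 2) ∞ M]
  [RiemannianBundle (fun x : M ↦ TangentSpace (𝓡 2) x)]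
  [IsContMDiffRiemannianBundle (𝓡 2) ∞ Plane (fun x : M ↦ TangentSpace (𝓡 2) x)]
  {o : SurfaceOrientation M} {c : ℝ} {f : M → ℝ} {E₁ E₂ : Π x : M, TangentSpace (𝓡 2) x}

/-- A smooth positive function `f` with `1 + K + 3 f² + c² f³ = 0` and a smooth positive orthonormal
frame `E₁, E₂` such that `f` decreases along `E₁` and is constant along `E₂`, and such that the
connection has the prescribed form. -/
structure IsSpecialFrame (o : SurfaceOrientation M) (c : ℝ) (f : M → ℝ)
    (E₁ E₂ : Π x : M, TangentSpace (𝓡 2) x) : Prop where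
  pos : ∀ x, 0 < f x
  gaussCurvature_eq : ∀ x, gaussCurvature M x = -1 - 3 * f x ^ 2 - c ^ 2 * f x ^ 3
  smooth : ∀ x, SmoothFunAt f x
  isFrameOn : IsFrameOn E₁ E₂ univ
  positive : ∀ x, IsPositiveBasis (o.toFun x) ![E₁ x, E₂ x]
  dirDeriv_fst : ∀ x, dirDeriv E₁ f x < 0
  dirDeriv_snd : ∀ x, dirDeriv E₂ f x = 0
  connFst_eq : ∀ x, connFst E₁ E₂ x = 0
  connSnd_eq : ∀ x, connSnd E₁ E₂ x = -(3 / 4 * (dirDeriv E₁ f x / f x))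

theorem HasSpecialConnection.exists_isSpecialFrame (h : HasSpecialConnection o c) :
    ∃ (f : M → ℝ) (E₁ E₂ : Π x : M, TangentSpace (𝓡 2) x), IsSpecialFrame o c f E₁ E₂ := by
  obtain ⟨-, hg, f, hf, E₁, E₂, hE, hL⟩ := h
  obtain rfl : E₁ = unitGrad M := funext hE.eq_gradient
  have hK : ∀ x, gaussCurvature M x = -1 - 3 * f x ^ 2 - c ^ 2 * f x ^ 3 :=
    fun x ↦ by linarith [(hf x).2]
  have hfs : ∀ x, SmoothFunAt f x := by
    intro x
    refine smoothFunAt_of_quadratic_add_cubic_eq (k := fun y ↦ -(1 + gaussCurvature M y))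
      (sq_nonneg c) (fun y ↦ (hf y).1) ?_ fun y ↦ by linarith [(hf y).2]
    exact smoothFunAt_neg (smoothFunAt_add contMDiffAt_const (smoothFunAt_gaussCurvature x))
  have hroot : ∀ (V : Π x : M, TangentSpace (𝓡 2) x) x, dirDeriv V (gaussCurvature M) x =
      -(6 * f x + 3 * c ^ 2 * f x ^ 2) * dirDeriv V f x := fun V x ↦
    dirDeriv_gaussCurvature_of_root (Filter.Eventually.of_forall hf) (hfs x).diffFunAt
  have hpos : ∀ x, 0 < 6 * f x + 3 * c ^ 2 * f x ^ 2 := fun x ↦ by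
    have := (hf x).1
    positivity
  have hfst : ∀ x, dirDeriv (unitGrad M) f x < 0 := by
    intro x
    have h1 := dirDeriv_unitGrad_gaussCurvature (hg x)
    rw [hroot] at h1
    by_contra! h2
    nlinarith [mul_nonneg (hpos x).le h2]
  have h₁ : ∀ x, SmoothFieldAt (unitGrad M) x := fun x ↦
    smoothFieldAt_unitField (smoothFieldAt_gradient (smoothFunAt_gaussCurvature x)) (hg x)
  have ho := fun x ↦ orthonormal_pair_iff.1 (hE.orthonormal x)
  have h₂ : ∀ x, SmoothFieldAt E₂ x := by
    intro x
    refine smoothFieldAt_of_orthonormal h₁ ?_ hE.orthonormal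
    refine diffFieldAt_of_leviCivita_ne_zero (v := E₂ x) ?_
    rw [(hL x).2.2.2]
    refine smul_ne_zero (mul_ne_zero (by norm_num) (div_ne_zero (hfst x).ne (hf x).1.ne')) ?_
    exact (hE.orthonormal x).ne_zero 0
  -- `E₂ f = 0` holds because `E₂ K = 0`, as `E₂` is orthogonal to the gradient of `K`
  refine ⟨f, unitGrad M, E₂, fun x ↦ (hf x).1, hK, hfs, ⟨isOpen_univ, fun x _ ↦ h₁ x,
    fun x _ ↦ h₂ x, fun x _ ↦ (ho x).1, fun x _ ↦ (ho x).2.1, fun x _ ↦ (ho x).2.2⟩, hE.positive,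
    hfst, fun x ↦ ?_, fun x ↦ ?_, fun x ↦ ?_⟩
  · have h1 : dirDeriv E₂ (gaussCurvature M) x = 0 := by
      have h2 := (ho x).2.1
      rw [hE.eq_gradient x, real_inner_smul_left, inner_gradient] at h2
      exact (mul_eq_zero.1 h2).resolve_left (inv_ne_zero (norm_ne_zero_iff.2 (hg x)))
    rw [hroot] at h1
    exact (mul_eq_zero.1 h1).resolve_left (neg_ne_zero.2 (hpos x).ne')
  · rw [connFst, connForm, (hL x).1, inner_zero_left]
  · rw [connSnd, connForm, (hL x).2.2.1, real_inner_smul_left, (ho x).2.2, mul_one]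
    rfl

end SpecialFrame

/-! ### From the form of the connection to special charts -/

section Profile

/-- A function on a disk whose derivative in the second coordinate direction vanishes depends on the
first coordinate only. -/
theorem eq_of_fderiv_single_one_eq_zero {G : Plane → ℝ} {z : Plane} {r : ℝ}
    (hG : ∀ q ∈ Metric.ball z r, DifferentiableAt ℝ G q)
    (hG' : ∀ q ∈ Metric.ball z r, fderiv ℝ G q (EuclideanSpace.single 1 1) = 0) {p q : Plane}
    (hp : p ∈ Metric.ball z r) (hq : q ∈ Metric.ball z r) (hpq : p 0 = q 0) : G p = G q := by
  obtain ⟨w, hw, h⟩ := domain_mvt (fun q hq ↦ (hG q hq).hasFDerivAt.hasFDerivWithinAt)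
    (convex_ball z r) hp hq
  have hw' := (convex_ball z r).segment_subset hp hq hw
  have h1 : q - p = (q 1 - p 1) • EuclideanSpace.single (1 : Fin 2) (1 : ℝ) := by
    ext i
    fin_cases i <;> simp [hpq]
  rw [h1, map_smul, hG' w hw', smul_zero] at h
  linarith

/-- The point with coordinates `(u, z 1)`. -/
def horizontalPoint (z : Plane) (u : ℝ) : Plane :=
  z + (u - z 0) • EuclideanSpace.single (0 : Fin 2) (1 : ℝ)

theorem horizontalPoint_zero (z : Plane) (u : ℝ) : horizontalPoint z u 0 = u := by
  simp [horizontalPoint]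

/-- The orthogonal projection to the horizontal diameter maps a disk into itself. -/
theorem horizontalPoint_mem_ball {z q : Plane} {r : ℝ} (hq : q ∈ Metric.ball z r) :
    horizontalPoint z (q 0) ∈ Metric.ball z r := by
  rw [mem_ball_iff_norm] at hq ⊢
  refine lt_of_le_of_lt ?_ hq
  have h1 : ‖(q - z) 0‖ ≤ ‖q - z‖ := PiLp.norm_apply_le (q - z) 0
  rw [horizontalPoint, add_sub_cancel_left, norm_smul, PiLp.norm_single, norm_one,
    mul_one]
  exact h1

theorem contDiff_horizontalPoint (z : Plane) : ContDiff ℝ ∞ (horizontalPoint z) := by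
  unfold horizontalPoint
  fun_prop

end Profile

section ExistsChart

variable {M : Type*} [TopologicalSpace M] [ChartedSpace Plane M] [IsManifold (𝓡 2) ∞ M]
  [RiemannianBundle (fun x : M ↦ TangentSpace (𝓡 2) x)]
  [IsContMDiffRiemannianBundle (𝓡 2) ∞ Plane (fun x : M ↦ TangentSpace (𝓡 2) x)]
  {o : SurfaceOrientation M} {c : ℝ} {f : M → ℝ} {E₁ E₂ : Π x : M, TangentSpace (𝓡 2) x}

namespace IsSpecialFrame

variable (h : IsSpecialFrame o c f E₁ E₂)
include h

theorem mlieBracket_eq (x : M) : VectorField.mlieBracket (𝓡 2) E₁ E₂ x =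
    (3 / 4 * (dirDeriv E₁ f x / f x)) • E₂ x := by
  rw [h.isFrameOn.mlieBracket_eq (mem_univ x), h.connFst_eq, h.connSnd_eq]
  module

theorem smoothFunAt_rpow (x : M) : SmoothFunAt (fun y ↦ -f y ^ (-(3 / 4) : ℝ)) x :=
  smoothFunAt_comp_real (φ := fun t ↦ -t ^ (-(3 / 4) : ℝ))
    (contDiffAt_id.rpow_const_of_ne (h.pos x).ne').neg (h.smooth x)

/-- The factor `f^(-3/4)` integrates `[E₁, E₂] = 3/4 (E₁ f / f) E₂`. -/
theorem mlieBracket_rescaled (x : M) : VectorField.mlieBracket (𝓡 2)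
    (fun y ↦ (-1 : ℝ) • E₁ y) (fun y ↦ (-f y ^ (-(3 / 4) : ℝ)) • E₂ y) x = 0 := by
  have h0 := h.pos x
  have h1 := (h.isFrameOn.smooth₁ x (mem_univ x)).diffFieldAt
  have h2 := (h.isFrameOn.smooth₂ x (mem_univ x)).diffFieldAt
  have h3 : VectorField.mlieBracket (𝓡 2) (fun y ↦ (-1 : ℝ) • E₁ y) E₂ x =
      (-1 : ℝ) • VectorField.mlieBracket (𝓡 2) E₁ E₂ x :=
    VectorField.mlieBracket_const_smul_left (I := 𝓡 2) (c := (-1 : ℝ)) (W := E₂) h1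
  have hd : HasDerivAt (fun t : ℝ ↦ -t ^ (-(3 / 4) : ℝ))
      (-(1 * (-(3 / 4)) * f x ^ ((-(3 / 4) : ℝ) - 1))) (f x) :=
    ((hasDerivAt_id (f x)).rpow_const (Or.inl h0.ne')).neg
  have h4 : dirDeriv (fun y ↦ (-1 : ℝ) • E₁ y) (fun y ↦ -f y ^ (-(3 / 4) : ℝ)) x =
      -dirDeriv E₁ (fun y ↦ -f y ^ (-(3 / 4) : ℝ)) x := by
    simp [dirDeriv]
  refine (mlieBracket_smul_right_apply (h.smoothFunAt_rpow x).diffFunAt h2).trans ?_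
  rw [h3, h.mlieBracket_eq, h4, dirDeriv_comp_real hd (h.smooth x).diffFunAt, smul_smul, smul_smul,
    ← add_smul, Real.rpow_sub_one h0.ne']
  refine (congrArg (fun t : ℝ ↦ t • E₂ x) ?_).trans (zero_smul ℝ (E₂ x))
  field_simp
  ring

/-- The fields `-E₁` and `-f^(-3/4) E₂` commute, and are the coordinate fields of a special
chart. -/
theorem exists_isSpecialChart (p : M) :
    ∃ (φ : OpenPartialHomeomorph M Plane) (F : ℝ → ℝ), p ∈ φ.source ∧ IsSpecialChart o c φ F := by
  have hE := h.isFrameOn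
  have hpow : ∀ x, 0 < f x ^ (-(3 / 4) : ℝ) := fun x ↦ Real.rpow_pos_of_pos (h.pos x) _
  obtain ⟨φ, hφ, hp, ⟨r, -, hr⟩, hφE⟩ := exists_chartField_eq
    (X := fun y ↦ (-1 : ℝ) • E₁ y) (Y := fun y ↦ (-f y ^ (-(3 / 4) : ℝ)) • E₂ y)
    (fun x ↦ (contMDiffAt_const (c := (-1 : ℝ)) : SmoothFunAt (fun _ : M ↦ (-1 : ℝ)) x).smul_section
      (hE.smooth₁ x (mem_univ x)))
    (fun x ↦ (h.smoothFunAt_rpow x).smul_section (hE.smooth₂ x (mem_univ x)))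
    h.mlieBracket_rescaled (fun x ↦ by
      obtain ⟨b, hb, -⟩ := (h.positive x).smul_smul (s := -1) (t := -f x ^ (-(3 / 4) : ℝ))
        (by linarith [hpow x])
      rw [← hb]
      exact b.linearIndependent) p
  set z := φ p with hz
  -- `f` in the chart, whose derivative in the second coordinate direction vanishes
  set G : Plane → ℝ := fun q ↦ f (φ.symm q) with hGdef
  have hGs : ∀ q ∈ φ.target, ContDiffAt ℝ ∞ G q := fun q hq ↦
    ((h.smooth (φ.symm q)).comp q (contMDiffAt_symm_of_mem_maximalAtlas hφ hq)).contDiffAt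
  have hGd : ∀ q ∈ φ.target, DifferentiableAt ℝ G q :=
    fun q hq ↦ (hGs q hq).differentiableAt (by simp)
  have hfG : ∀ x ∈ φ.source, f =ᶠ[𝓝 x] fun y ↦ G (φ y) := by
    intro x hx
    filter_upwards [φ.open_source.mem_nhds hx] with y hy
    simp only [hGdef, φ.left_inv hy]
  have hG' : ∀ q ∈ φ.target, fderiv ℝ G q (EuclideanSpace.single 1 1) = 0 := by
    intro q hq
    have hx := φ.map_target hq
    have h1 := dirDeriv_chartField_comp hφ hx (g := G) (by rw [φ.right_inv hq]; exact hGd q hq) 1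
    rw [φ.right_inv hq, ← dirDeriv_congr (hfG _ hx), dirDeriv, (hφE _ hx).2, map_smul] at h1
    rw [← h1]
    change _ • dirDeriv E₂ f _ = 0
    rw [h.dirDeriv_snd, smul_zero]
  -- the target of the chart is a disk, hence `f` is a function of the first coordinate
  set F : ℝ → ℝ := fun u ↦ G (horizontalPoint z u) with hFdef
  have hmem : ∀ q ∈ φ.target, horizontalPoint z (q 0) ∈ φ.target := by
    intro q hq
    rw [hr] at hq ⊢
    exact horizontalPoint_mem_ball hq
  have hGF : ∀ q ∈ φ.target, G q = F (q 0) := by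
    intro q hq
    have hq' := hmem q hq
    rw [hr] at hq hq' hGd hG'
    exact eq_of_fderiv_single_one_eq_zero hGd hG' hq hq' (horizontalPoint_zero z (q 0)).symm
  have hfF : ∀ x ∈ φ.source, f x = F (φ x 0) := by
    intro x hx
    rw [← hGF _ (φ.map_source hx)]
    simp only [hGdef, φ.left_inv hx]
  have hFs : ∀ x ∈ φ.source, ContDiffAt ℝ ∞ F (φ x 0) := fun x hx ↦
    ContDiffAt.comp (g := G) (φ x 0) (hGs _ (hmem _ (φ.map_source hx)))
      (contDiff_horizontalPoint z).contDiffAt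
  have hDo := isOpen_image_fst φ.open_target
  have hD : ∀ u ∈ (fun q : Plane ↦ q 0) '' φ.target, ∃ x ∈ φ.source, φ x 0 = u := by
    rintro u ⟨q, hq, rfl⟩
    exact ⟨φ.symm q, φ.map_target hq, by rw [φ.right_inv hq]⟩
  have hFc : ContDiffOn ℝ ∞ F ((fun q : Plane ↦ q 0) '' φ.target) := by
    intro u hu
    obtain ⟨x, hx, rfl⟩ := hD u hu
    exact (hFs x hx).contDiffWithinAt
  have hFd : ∀ x ∈ φ.source, HasDerivAt F (deriv F (φ x 0)) (φ x 0) :=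
    fun x hx ↦ ((hFs x hx).differentiableAt (by simp)).hasDerivAt
  have hFd' : ∀ x ∈ φ.source, HasDerivAt (deriv F) (deriv (deriv F) (φ x 0)) (φ x 0) := by
    intro x hx
    have h1 := ((contDiffOn_infty_iff_deriv_of_isOpen hDo).1 hFc).2.contDiffAt
      (hDo.mem_nhds ⟨_, φ.map_source hx, rfl⟩)
    exact (h1.differentiableAt (by simp)).hasDerivAt
  have hE₁ : ∀ (g : M → ℝ), ∀ x ∈ φ.source,
      dirDeriv E₁ g x = -dirDeriv (chartField φ 0) g x := by
    intro g x hx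
    rw [dirDeriv, dirDeriv, (hφE x hx).1, map_smul, smul_eq_mul]
    ring
  have hfst : ∀ x ∈ φ.source, dirDeriv E₁ f x = -deriv F (φ x 0) := by
    intro x hx
    have h1 : f =ᶠ[𝓝 x] fun y ↦ F (φ y 0) := by
      filter_upwards [φ.open_source.mem_nhds hx] with y hy using hfF y hy
    rw [dirDeriv_congr h1, hE₁ _ x hx, dirDeriv_chartField_zero_fst hφ hx (hFd x hx)]
  have hpos : ∀ x ∈ φ.source, 0 < F (φ x 0) := fun x hx ↦ hfF x hx ▸ h.pos x
  have hsymm : ∀ q ∈ φ.target, f (φ.symm q) = F (q 0) := hGF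
  have hcoord : ∀ q ∈ φ.target, coordVec φ q =
      ![(-1 : ℝ) • E₁ (φ.symm q), (-f (φ.symm q) ^ (-(3 / 4) : ℝ)) • E₂ (φ.symm q)] := by
    intro q hq
    ext i
    rw [coordVec_eq_chartField hφ hq]
    fin_cases i
    exacts [(hφE _ (φ.map_target hq)).1, (hφE _ (φ.map_target hq)).2]
  refine ⟨φ, F, hp, ⟨hφ, fun q hq ↦ ?_⟩, hFc, fun u hu ↦ ?_, fun u hu ↦ ?_, fun u hu ↦ ?_,
    fun q hq ↦ ?_, fun q hq ↦ ?_, fun q hq ↦ ?_⟩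
  · rw [hcoord q hq]
    exact (h.positive _).smul_smul (by linarith [hpow (φ.symm q)])
  · obtain ⟨x, hx, rfl⟩ := hD u hu
    exact hpos x hx
  · obtain ⟨x, hx, rfl⟩ := hD u hu
    linarith [hfst x hx, h.dirDeriv_fst x]
  · obtain ⟨x, hx, rfl⟩ := hD u hu
    have h0 := hpos x hx
    -- the curvature formula with `a = 0` and `b = 3/4 F'/F` is the differential equation
    have ha : connFst E₁ E₂ = fun _ ↦ 0 := funext h.connFst_eq
    have hb : connSnd E₁ E₂ =ᶠ[𝓝 x] fun y ↦ 3 / 4 * (deriv F (φ y 0) / F (φ y 0)) := by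
      filter_upwards [φ.open_source.mem_nhds hx] with y hy
      rw [h.connSnd_eq, hfst y hy, hfF y hy]
      ring
    have hd := ((hFd' x hx).div (hFd x hx) h0.ne').const_mul (3 / 4)
    have hK := hE.gaussCurvature_eq (mem_univ x)
    rw [h.gaussCurvature_eq, dirDeriv_congr hb, hb.self_of_nhds, ha, dirDeriv_const, hE₁ _ x hx,
      dirDeriv_chartField_zero_fst (g := fun t ↦ 3 / 4 * (deriv F t / F t)) hφ hx hd,
      hfF x hx] at hK
    field_simp at hK
    linear_combination -hK / 12
  · rw [hcoord q hq]
    simp only [Matrix.cons_val_zero, real_inner_smul_left, real_inner_smul_right,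
      hE.inner₁₁ _ (mem_univ _)]
    norm_num
  · rw [hcoord q hq]
    simp only [Matrix.cons_val_zero, Matrix.cons_val_one, real_inner_smul_left,
      real_inner_smul_right, hE.inner₁₂ _ (mem_univ _), mul_zero]
  · rw [hcoord q hq]
    simp only [Matrix.cons_val_one, Matrix.cons_val_zero, real_inner_smul_left,
      real_inner_smul_right, hE.inner₂₂ _ (mem_univ _), hsymm q hq, mul_one]
    have h0 : 0 < F (q 0) := hsymm q hq ▸ h.pos _
    rw [neg_mul_neg, ← Real.rpow_add h0, one_div, ← Real.rpow_neg h0.le]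
    norm_num

end IsSpecialFrame
end ExistsChart

end SurfaceGeometry

end

theorem mainTheorem7 {M : Type*} [TopologicalSpace M] [T2Space M] [SecondCountableTopology M]
    [ConnectedSpace M] [ChartedSpace SurfaceGeometry.Plane M] [IsManifold (𝓡 2) ∞ M]
    [RiemannianBundle (fun x : M ↦ TangentSpace (𝓡 2) x)]
    [IsContMDiffRiemannianBundle (𝓡 2) ∞ SurfaceGeometry.Plane
      (fun x : M ↦ TangentSpace (𝓡 2) x)]
    (o : SurfaceGeometry.SurfaceOrientation M) :
    ((∀ p : M, ∃ c : ℝ, c ≠ 0 ∧ ∃ (φ : OpenPartialHomeomorph M SurfaceGeometry.Plane) (f : ℝ → ℝ),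
        p ∈ φ.source ∧ SurfaceGeometry.IsSpecialChart o c φ f) ↔
      ∃ c : ℝ, c ≠ 0 ∧ SurfaceGeometry.HasSpecialConnection o c) ∧
    ∀ c : ℝ, c ≠ 0 →
      ((∀ p : M, ∃ (φ : OpenPartialHomeomorph M SurfaceGeometry.Plane) (f : ℝ → ℝ),
        p ∈ φ.source ∧ SurfaceGeometry.IsSpecialChart o c φ f) ↔
      SurfaceGeometry.HasSpecialConnection o c) :=
  ⟨⟨SurfaceGeometry.exists_hasSpecialConnection, fun ⟨c, hc, h⟩ p ↦
      let ⟨_, _, _, hF⟩ := h.exists_isSpecialFrame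
      ⟨c, hc, hF.exists_isSpecialChart p⟩⟩,
    fun _ hc ↦ ⟨SurfaceGeometry.hasSpecialConnection_of_forall_isSpecialChart hc, fun h p ↦
      let ⟨_, _, _, hF⟩ := h.exists_isSpecialFrame
      hF.exists_isSpecialChart p⟩⟩
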